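/- For each $n\ge 1$ let $X_{1,n},\dots,X_{n,n}$ be independent nonnegative random variables (different rows may live on different probability spaces) whose tails are regularly varying: there are $\beta_{k,n}\in(0,2)\setminus\{1\}$ such that $\mathbb P[X_{k,n}>\Lambda x]/\mathbb P[X_{k,n}>x]\to\Lambda^{-\beta_{k,n}}$ as $x\to\infty$ for every $\Lambda>0$. Let $S_n=\sum_{k=1}^n X_{k,n}$. If $\min_{1\le k\le n}\beta_{k,n}<1$, put $b_n=0$ and $m_{k,n}=0$ for all $k\le n$; if $\min_{1\le k\le n}\beta_{k,n}>1$, put $b_n=\mathbb E[S_n]$ and $m_{k,n}=\mathbb E[X_{k,n}]$. For $s>0$ define $$a_{k,n}(s)=\mathbb E\big[e^{-s(X_{k,n}-m_{k,n})}\big]-1,\qquad A_n(s)=\sum_{k=1}^n a_{k,n}(s).$$ Suppose that there are $\beta\in(0,2)\setminus\{1\}$, a family $L_n(x)=c_n\,\ell(x)$, $x>0$, with constants $c_n>0$ and an eventually positive function $\ell$ that is slowly varying at infinity (that is, $\ell(\Lambda x)/\ell(x)\to1$ as $x\to\infty$ for every $\Lambda>0$), and a sequence $s_n>0$ with $s_n\to0$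 such that, for every $\lambda>0$, $$\lim_{n\to\infty}\ \sup_{0<s\le\lambda s_n}\left|\ \left|\frac{A_n(s)}{\Gamma(1-\beta)L_n(1/s)s^{\beta}}\right|-1\right|=0,$$ and such that $A_n(s_n)\to0$ as $n\to\infty$. Then $$\lim_{n\to\infty}\ \sup_{x\ge 1/s_n}\left|\frac{\mathbb P[S_n-b_n>x]}{L_n(x)\,x^{-\beta}}-1\right|=0.$$ -/

import Mathlib

open Filter Topology MeasureTheory ProbabilityTheory

noncomputable section

namespace RegVar

/-- The (right) tail of `X` under `P` is regularly varying with index `-ρ`: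
`P[X > Λ x] / P[X > x] → Λ ^ (-ρ)` as `x → ∞`, for every `Λ > 0`. -/
def TailRegularlyVarying {Ω : Type*} [MeasurableSpace Ω] (P : Measure Ω) (X : Ω → ℝ) (ρ : ℝ) :
    Prop :=
  ∀ Λ : ℝ, 0 < Λ →
    Tendsto (fun x : ℝ => P.real {ω | Λ * x < X ω} / P.real {ω | x < X ω}) atTop (𝓝 (Λ ^ (-ρ)))

/-- `ℓ` is slowly varying at infinity: `ℓ (Λ x) / ℓ x → 1` as `x → ∞`, for every `Λ > 0`. -/
def SlowlyVarying (ℓ : ℝ → ℝ) : Prop :=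
  ∀ Λ : ℝ, 0 < Λ → Tendsto (fun x : ℝ => ℓ (Λ * x) / ℓ x) atTop (𝓝 1)

/-- The sequence `(L n)`, `n ≥ 1`, is a positive separable family of slowly varying functions:
`L n x = c n * ℓ x` with `c n > 0` and `ℓ` slowly varying and eventually positive. -/
def PosSepSlowlyVarying (L : ℕ → ℝ → ℝ) : Prop :=
  ∃ (c : ℕ → ℝ) (ℓ : ℝ → ℝ), SlowlyVarying ℓ ∧ (∀ᶠ x in atTop, 0 < ℓ x) ∧
    (∀ n, 1 ≤ n → 0 < c n) ∧ ∀ n, 1 ≤ n → ∀ x : ℝ, 0 < x → L n x = c n * ℓ x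

section Array

variable {Ω : ℕ → Type*} [∀ n, MeasurableSpace (Ω n)]

/-- The row sum `S n = ∑ k, X n k`. -/
def rowSum (X : ∀ n, Fin n → Ω n → ℝ) (n : ℕ) (ω : Ω n) : ℝ :=
  ∑ k, X n k ω

/-- The smallest index `min_k βi n k` of the `n`-th row (used for `n ≥ 1`). -/
def minIndex (βi : ∀ n, Fin n → ℝ) (n : ℕ) : ℝ :=
  ⨅ k, βi n k

/-- The centering `b n`: `0` if the smallest index of the row is below `1`, and `E[S n]`
otherwise. -/
def centering (P : ∀ n, Measure (Ω n)) (X : ∀ n, Fin n → Ω n → ℝ) (βi : ∀ n, Fin n → ℝ)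
    (n : ℕ) : ℝ :=
  if minIndex βi n < 1 then 0 else ∫ ω, rowSum X n ω ∂(P n)

/-- The centering of a single entry: `0` if the smallest index of its row is below `1`, and
`E[X n k]` otherwise. -/
def entryCentering (P : ∀ n, Measure (Ω n)) (X : ∀ n, Fin n → Ω n → ℝ) (βi : ∀ n, Fin n → ℝ)
    (n : ℕ) (k : Fin n) : ℝ :=
  if minIndex βi n < 1 then 0 else ∫ ω, X n k ω ∂(P n)

/-- `a_{k,n}(s)`: the Laplace-Stieltjes transform at `s` of the law of the (possibly centered)
entry, minus `1`. -/
def transformDeviation (P : ∀ n, Measure (Ω n)) (X : ∀ n, Fin n → Ω n → ℝ)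
    (βi : ∀ n, Fin n → ℝ) (n : ℕ) (k : Fin n) (s : ℝ) : ℝ :=
  (∫ ω, Real.exp (-s * (X n k ω - entryCentering P X βi n k)) ∂(P n)) - 1

/-- `A_n(s) = ∑ k, a_{k,n}(s)`. -/
def sumDeviation (P : ∀ n, Measure (Ω n)) (X : ∀ n, Fin n → Ω n → ℝ)
    (βi : ∀ n, Fin n → ℝ) (n : ℕ) (s : ℝ) : ℝ :=
  ∑ k, transformDeviation P X βi n k s

end Array

end RegVar

end

/-! Uniform convergence on `x ≥ 1/s_n` is convergence along every sequence `x_n ≥ 1/s_n`. Fix one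
and put `T_n = (S_n - b_n)/x_n` and `δ_n = L_n(x_n) x_n^{-β}`; the claim becomes `P[T_n > 1]/δ_n →
1`.

By independence, `E[e^{-kT_n}]` is the product of the factors `1 + a_{j,n}(k/x_n)`. Within a row all
deviations have the same sign: nonpositive without centering, nonnegative (by Jensen) with it. Hence
the sum of their absolute values is `|A_n|`, and the product differs from `1 + A_n` by at most
`A_n²` once `|A_n| ≤ 1`. The hypothesis controls only `|A_n|`; its sign is recovered from convexity,
which forces the uncentered regime when `β < 1` and the centered one when `β > 1`. Since `δ_n → 0`,
the quadratic error is negligible and `(E[e^{-kT_n}] - 1)/δ_n → -Γ(1-β) k^β` for every natural `k`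
(`tendsto_tail_ratio`).

The Tauberian step (`tendsto_measureReal_one_lt_div`) is a moment argument in `U = e^{-T_n}`. Second
differences in `k` turn the limits into convergence of `E[(1-U)² U^k]/δ_n` to the moments of
`(1-e^{-x})² β x^{-β-1} dx` (`integral_expSecondDiff_mul_rpow`). The factor `(1-e^{-x})²` makes this
measure finite for every `β < 2`, so both regimes are handled at once. The limit variable `e^{-x}`
lies in `[0,1]`, hence moments determine the limit of bounded continuous test functions, even though
`U` may be unbounded (`tendsto_integral_comp_of_tendsto_moments`). Ramps divided by `(1-u)²` then
squeeze the indicator of `T_n > 1`. -/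

/-! ### Moment method with a limit variable in `[0, 1]` -/

/-- A polynomial approximating a bounded continuous function on `[0, 2]`, with an error term of
arbitrarily high degree and small coefficient outside. -/
theorem exists_polynomial_near_with_moment_error {f : ℝ → ℝ} (hf : Continuous f) {B : ℝ}
    (hB : ∀ x, |f x| ≤ B) {ε : ℝ} (hε : 0 < ε) :
    ∃ (p : Polynomial ℝ) (m : ℕ), ∀ u : ℝ, 0 ≤ u → |f u - p.eval u| ≤ ε + ε * u ^ m := by
  obtain ⟨p, hp⟩ := exists_polynomial_near_of_continuousOn 0 2 f hf.continuousOn ε hε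
  set d := p.natDegree
  set D := ∑ i ∈ Finset.range (d + 1), |p.coeff i|
  have hB0 : 0 ≤ B := (abs_nonneg _).trans (hB 0)
  have hD0 : 0 ≤ D := Finset.sum_nonneg fun i _ => abs_nonneg _
  have hpb : ∀ u : ℝ, 1 ≤ u → |p.eval u| ≤ D * u ^ d := by
    intro u hu
    rw [Polynomial.eval_eq_sum_range, Finset.sum_mul]
    refine (Finset.abs_sum_le_sum_abs _ _).trans (Finset.sum_le_sum fun i hi => ?_)
    rw [abs_mul, abs_of_nonneg (pow_nonneg (by linarith : (0 : ℝ) ≤ u) i)]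
    exact mul_le_mul_of_nonneg_left
      (pow_le_pow_right₀ hu (by simpa [Nat.lt_succ_iff] using hi)) (abs_nonneg _)
  -- Beyond `2` both `f` and the polynomial are at most a constant times `u ^ d`; the extra factor
  -- `u ^ j ≥ 2 ^ j` pays for that constant with coefficient `ε`.
  obtain ⟨j, hj⟩ := pow_unbounded_of_one_lt ((B + D) / ε) (by norm_num : (1 : ℝ) < 2)
  rw [div_lt_iff₀ hε] at hj
  refine ⟨p, d + j, fun u hu => ?_⟩
  rcases le_total u 2 with h2 | h2
  · have := hp u ⟨hu, h2⟩
    rw [abs_sub_comm] at this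
    have : 0 ≤ ε * u ^ (d + j) := by positivity
    linarith
  · have h1 : (1 : ℝ) ≤ u ^ d := one_le_pow₀ (by linarith)
    have h3 : (2 : ℝ) ^ j ≤ u ^ j := pow_le_pow_left₀ (by norm_num) h2 j
    calc |f u - p.eval u| ≤ |f u| + |p.eval u| := abs_sub _ _
      _ ≤ B * u ^ d + D * u ^ d :=
        add_le_add ((hB u).trans (le_mul_of_one_le_right hB0 h1)) (hpb u (by linarith))
      _ = (B + D) * u ^ d := by ring
      _ ≤ (u ^ j * ε) * u ^ d := by
        apply mul_le_mul_of_nonneg_right _ (by positivity)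
        nlinarith
      _ = ε * u ^ (d + j) := by ring
      _ ≤ ε + ε * u ^ (d + j) := by linarith

theorem integrable_mul_polynomial_eval {α : Type*} [MeasurableSpace α] {ν : Measure α}
    {U w : α → ℝ} (hint : ∀ k : ℕ, Integrable (fun a => w a * U a ^ k) ν) (p : Polynomial ℝ) :
    Integrable (fun a => w a * p.eval (U a)) ν := by
  have : (fun a => w a * p.eval (U a)) =
      fun a => ∑ i ∈ Finset.range (p.natDegree + 1), p.coeff i * (w a * U a ^ i) := by
    funext a
    rw [Polynomial.eval_eq_sum_range, Finset.mul_sum]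
    exact Finset.sum_congr rfl fun i _ => by ring
  rw [this]
  exact integrable_finsetSum _ fun i _ => (hint i).const_mul _

theorem integral_mul_polynomial_eval {α : Type*} [MeasurableSpace α] {ν : Measure α}
    {U w : α → ℝ} (hint : ∀ k : ℕ, Integrable (fun a => w a * U a ^ k) ν) (p : Polynomial ℝ) :
    ∫ a, w a * p.eval (U a) ∂ν =
      ∑ i ∈ Finset.range (p.natDegree + 1), p.coeff i * ∫ a, w a * U a ^ i ∂ν := by
  have : (fun a => w a * p.eval (U a)) =
      fun a => ∑ i ∈ Finset.range (p.natDegree + 1), p.coeff i * (w a * U a ^ i) := by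
    funext a
    rw [Polynomial.eval_eq_sum_range, Finset.mul_sum]
    exact Finset.sum_congr rfl fun i _ => by ring
  rw [this, integral_finsetSum _ fun i _ => (hint i).const_mul _]
  exact Finset.sum_congr rfl fun i _ => integral_const_mul _ _

theorem integrable_mul_comp_of_bounded {α : Type*} [MeasurableSpace α] {ν : Measure α}
    {U w : α → ℝ} (hU : Measurable U) (hw : Integrable w ν) {f : ℝ → ℝ} (hf : Continuous f)
    {B : ℝ} (hB : ∀ x, |f x| ≤ B) : Integrable (fun a => w a * f (U a)) ν :=
  hw.mul_bdd (c := B) (hf.measurable.comp hU).aestronglyMeasurable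
    (Eventually.of_forall fun a => hB (U a))

/-- The approximation error is integrated against the weight. Only moments of orders `0` and `m`
remain, and these converge by assumption, so no truncation of an unbounded `U` is needed. -/
theorem abs_integral_mul_comp_sub_polynomial_le {α : Type*} [MeasurableSpace α] {ν : Measure α}
    {U w : α → ℝ} (hU : Measurable U) (hU0 : ∀ᵐ a ∂ν, 0 ≤ U a) (hw : ∀ᵐ a ∂ν, 0 ≤ w a)
    (hint : ∀ k : ℕ, Integrable (fun a => w a * U a ^ k) ν) {f : ℝ → ℝ} (hf : Continuous f)
    {B : ℝ} (hB : ∀ x, |f x| ≤ B) {p : Polynomial ℝ} {m : ℕ} {ε : ℝ}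
    (hp : ∀ u : ℝ, 0 ≤ u → |f u - p.eval u| ≤ ε + ε * u ^ m) :
    |∫ a, w a * f (U a) ∂ν - ∫ a, w a * p.eval (U a) ∂ν| ≤
      ε * ∫ a, w a * U a ^ 0 ∂ν + ε * ∫ a, w a * U a ^ m ∂ν := by
  have hw1 : Integrable w ν := by simpa using hint 0
  rw [← integral_sub (integrable_mul_comp_of_bounded hU hw1 hf hB)
    (integrable_mul_polynomial_eval hint p), ← integral_const_mul, ← integral_const_mul,
    ← integral_add ((hint 0).const_mul _) ((hint m).const_mul _)]
  refine abs_integral_le_integral_abs.trans (integral_mono_ae ?_ ?_ ?_)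
  · exact ((integrable_mul_comp_of_bounded hU hw1 hf hB).sub
      (integrable_mul_polynomial_eval hint p)).abs
  · exact ((hint 0).const_mul _).add ((hint m).const_mul _)
  · filter_upwards [hU0, hw] with a ha hwa
    rw [← mul_sub, abs_mul, abs_of_nonneg hwa]
    calc w a * |f (U a) - p.eval (U a)| ≤ w a * (ε + ε * U a ^ m) :=
          mul_le_mul_of_nonneg_left (hp _ ha) hwa
      _ = _ := by ring

/-- Convergence of all moments of nonnegative variables under weights `w n` to the moments of a
`[0, 1]`-valued variable implies convergence of the integrals of bounded continuous functions. -/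
theorem tendsto_integral_comp_of_tendsto_moments
    {Ω : ℕ → Type*} [∀ n, MeasurableSpace (Ω n)] {P : ∀ n, Measure (Ω n)}
    {U w : ∀ n, Ω n → ℝ} {α : Type*} [MeasurableSpace α] {ν : Measure α} {V v : α → ℝ}
    (hU : ∀ n, Measurable (U n)) (hU0 : ∀ n ω, 0 ≤ U n ω)
    (hw : ∀ᶠ n in atTop, ∀ ω, 0 ≤ w n ω)
    (hint : ∀ᶠ n in atTop, ∀ k : ℕ, Integrable (fun ω => w n ω * U n ω ^ k) (P n))
    (hV : Measurable V) (hV01 : ∀ᵐ a ∂ν, 0 ≤ V a ∧ V a ≤ 1) (hv : ∀ᵐ a ∂ν, 0 ≤ v a)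
    (hvint : Integrable v ν)
    (hlim : ∀ k : ℕ, Tendsto (fun n => ∫ ω, w n ω * U n ω ^ k ∂(P n)) atTop
      (𝓝 (∫ a, v a * V a ^ k ∂ν)))
    {f : ℝ → ℝ} (hf : Continuous f) {B : ℝ} (hB : ∀ x, |f x| ≤ B) :
    Tendsto (fun n => ∫ ω, w n ω * f (U n ω) ∂(P n)) atTop (𝓝 (∫ a, v a * f (V a) ∂ν)) := by
  have hvk : ∀ k : ℕ, Integrable (fun a => v a * V a ^ k) ν := fun k => by
    refine hvint.mul_bdd (c := 1) (hV.pow_const k).aestronglyMeasurable ?_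
    filter_upwards [hV01] with a ha
    rw [Real.norm_of_nonneg (pow_nonneg ha.1 k)]
    exact pow_le_one₀ ha.1 ha.2
  set M := ∫ a, v a ∂ν
  have hM : 0 ≤ M := integral_nonneg_of_ae hv
  have hMk : ∀ k : ℕ, ∫ a, v a * V a ^ k ∂ν ≤ M := fun k => by
    refine integral_mono_ae (hvk k) hvint ?_
    filter_upwards [hV01, hv] with a ha hva
    exact mul_le_of_le_one_right hva (pow_le_one₀ ha.1 ha.2)
  rw [Metric.tendsto_atTop']
  intro ε hε
  -- In the limit both error moments are at most `M`, because `V ≤ 1`; this `η` keeps their total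
  -- below `ε / 3`, also when `M = 0`.
  set η := ε / (6 * (M + 1)) with hη
  have hη0 : 0 < η := by positivity
  have hηM : η * M + η * M < ε / 3 := by
    have : η * (M + 1) = ε / 6 := by rw [hη]; field_simp
    nlinarith
  obtain ⟨p, m, hp⟩ := exists_polynomial_near_with_moment_error hf hB hη0
  have hpoly : Tendsto (fun n => ∫ ω, w n ω * p.eval (U n ω) ∂(P n)) atTop
      (𝓝 (∫ a, v a * p.eval (V a) ∂ν)) := by
    rw [integral_mul_polynomial_eval hvk p]
    refine (tendsto_finsetSum _ fun i _ => (hlim i).const_mul (p.coeff i)).congr' ?_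
    filter_upwards [hint] with n hn
    rw [integral_mul_polynomial_eval hn p]
  have herr := ((hlim 0).const_mul η).add ((hlim m).const_mul η)
  have hlimerr : η * ∫ a, v a * V a ^ 0 ∂ν + η * ∫ a, v a * V a ^ m ∂ν < ε / 3 :=
    lt_of_le_of_lt (add_le_add (mul_le_mul_of_nonneg_left (hMk 0) hη0.le)
      (mul_le_mul_of_nonneg_left (hMk m) hη0.le)) hηM
  have hv' := abs_integral_mul_comp_sub_polynomial_le hV (hV01.mono fun a ha => ha.1) hv hvk hf
    hB hp
  have key : ∀ᶠ n in atTop, dist (∫ ω, w n ω * f (U n ω) ∂(P n)) (∫ a, v a * f (V a) ∂ν) < ε := by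
    filter_upwards [hw, hint, herr.eventually_lt_const hlimerr,
      Metric.tendsto_nhds.1 hpoly (ε / 3) (by positivity)] with n hwn hin hen hpn
    have h1 := abs_integral_mul_comp_sub_polynomial_le (hU n) (Eventually.of_forall (hU0 n))
      (Eventually.of_forall hwn) hin hf hB hp
    rw [Real.dist_eq] at hpn ⊢
    rw [abs_lt] at hpn ⊢
    rw [abs_le] at h1 hv'
    constructor <;> linarith [h1.1, h1.2, hv'.1, hv'.2, hpn.1, hpn.2]
  obtain ⟨N, hN⟩ := eventually_atTop.1 key
  exact ⟨N, fun n hn => hN n hn.le⟩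

/-! ### Gamma integrals of second differences of exponentials -/

theorem integrableOn_pow_mul_rpow_mul_exp_neg {a : ℝ} (ha : 0 < a) {p : ℕ} (hp : p ≠ 0) (j : ℕ) :
    IntegrableOn (fun x : ℝ => (j : ℝ) ^ p * (x ^ (a - 1) * Real.exp (-(j * x)))) (Set.Ioi 0) := by
  rcases Nat.eq_zero_or_pos j with rfl | hj
  · simp [hp, IntegrableOn]
  · have := integrableOn_rpow_mul_exp_neg_mul_rpow (s := a - 1) (by linarith) one_pos
      (Nat.cast_pos.2 hj : (0 : ℝ) < j)
    simp only [Real.rpow_one, neg_mul] at this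
    exact Integrable.const_mul this _

/-- Keeping the factor `j ^ p` inside makes `j = 0` a genuine instance, with both sides zero, so the
term without exponential decay needs no separate treatment later. -/
theorem integral_pow_mul_rpow_mul_exp_neg {a : ℝ} (ha : 0 < a) {p : ℕ} (hp : p ≠ 0)
    (hpa : (p : ℝ) - a ≠ 0) (j : ℕ) :
    ∫ x in Set.Ioi (0 : ℝ), (j : ℝ) ^ p * (x ^ (a - 1) * Real.exp (-(j * x))) =
      Real.Gamma a * (j : ℝ) ^ ((p : ℝ) - a) := by
  rcases Nat.eq_zero_or_pos j with rfl | hj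
  · simp [hp, Real.zero_rpow hpa]
  · have hj' : (0 : ℝ) < j := Nat.cast_pos.2 hj
    rw [integral_const_mul, Real.integral_rpow_mul_exp_neg_mul_Ioi ha hj', one_div,
      Real.inv_rpow hj'.le, Real.rpow_sub hj', Real.rpow_natCast]
    field_simp

/-- The function `e^{-kx} (1 - e^{-x})²`. -/
noncomputable def expSecondDiff (k : ℕ) (x : ℝ) : ℝ :=
  (1 - Real.exp (-x)) ^ 2 * Real.exp (-x) ^ k

/-- The derivative of `expSecondDiff k`. -/
noncomputable def expSecondDiffDeriv (k : ℕ) (x : ℝ) : ℝ :=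
  2 * ((k + 1 : ℕ) * Real.exp (-((k + 1 : ℕ) * x))) - k * Real.exp (-(k * x))
    - (k + 2 : ℕ) * Real.exp (-((k + 2 : ℕ) * x))

/-- The second derivative of `expSecondDiff k`. -/
noncomputable def expSecondDiffDerivTwo (k : ℕ) (x : ℝ) : ℝ :=
  (k : ℝ) ^ 2 * Real.exp (-(k * x)) - 2 * (((k + 1 : ℕ) : ℝ) ^ 2 * Real.exp (-((k + 1 : ℕ) * x)))
    + ((k + 2 : ℕ) : ℝ) ^ 2 * Real.exp (-((k + 2 : ℕ) * x))

theorem exp_neg_pow (k : ℕ) (x : ℝ) : Real.exp (-x) ^ k = Real.exp (-(k * x)) := by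
  rw [← Real.exp_nat_mul]; congr 1; ring

theorem hasDerivAt_exp_neg_mul (c x : ℝ) :
    HasDerivAt (fun x => Real.exp (-(c * x))) (-(c * Real.exp (-(c * x)))) x := by
  have h : HasDerivAt (fun x => -(c * x)) (-(c * 1)) x := ((hasDerivAt_id x).const_mul c).neg
  exact h.exp.congr_deriv (by ring)

theorem expSecondDiff_eq (k : ℕ) (x : ℝ) :
    expSecondDiff k x = Real.exp (-(k * x)) - 2 * Real.exp (-((k + 1 : ℕ) * x))
      + Real.exp (-((k + 2 : ℕ) * x)) := by
  simp only [expSecondDiff, ← exp_neg_pow]; ring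

theorem hasDerivAt_expSecondDiff (k : ℕ) (x : ℝ) :
    HasDerivAt (expSecondDiff k) (expSecondDiffDeriv k x) x := by
  have h := ((hasDerivAt_exp_neg_mul k x).sub
    ((hasDerivAt_exp_neg_mul (k + 1 : ℕ) x).const_mul 2)).add
      (hasDerivAt_exp_neg_mul (k + 2 : ℕ) x)
  have e : expSecondDiff k = ((fun x : ℝ => Real.exp (-(k * x))) -
      fun x => 2 * Real.exp (-((k + 1 : ℕ) * x))) + fun x => Real.exp (-((k + 2 : ℕ) * x)) :=
    funext fun x => expSecondDiff_eq k x
  rw [e]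
  exact h.congr_deriv (by simp only [expSecondDiffDeriv]; ring)

theorem hasDerivAt_expSecondDiffDeriv (k : ℕ) (x : ℝ) :
    HasDerivAt (expSecondDiffDeriv k) (expSecondDiffDerivTwo k x) x := by
  have h := ((((hasDerivAt_exp_neg_mul (k + 1 : ℕ) x).const_mul ((k + 1 : ℕ) : ℝ)).const_mul 2).sub
    ((hasDerivAt_exp_neg_mul k x).const_mul (k : ℝ))).sub
      ((hasDerivAt_exp_neg_mul (k + 2 : ℕ) x).const_mul ((k + 2 : ℕ) : ℝ))
  exact h.congr_deriv (by simp only [expSecondDiffDerivTwo]; ring)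

theorem one_sub_exp_neg_mem {x : ℝ} (hx : 0 ≤ x) :
    0 ≤ 1 - Real.exp (-x) ∧ 1 - Real.exp (-x) ≤ x ∧ 1 - Real.exp (-x) ≤ 1 := by
  refine ⟨?_, ?_, ?_⟩
  · linarith [Real.exp_le_one_iff.2 (by linarith : -x ≤ 0)]
  · linarith [Real.add_one_le_exp (-x)]
  · linarith [Real.exp_pos (-x)]

theorem expSecondDiff_nonneg (k : ℕ) (x : ℝ) : 0 ≤ expSecondDiff k x := by
  unfold expSecondDiff; positivity

theorem expSecondDiff_le {k : ℕ} {x : ℝ} (hx : 0 ≤ x) :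
    expSecondDiff k x ≤ x ^ 2 ∧ expSecondDiff k x ≤ 1 := by
  obtain ⟨h0, h1, h2⟩ := one_sub_exp_neg_mem hx
  have hk : Real.exp (-x) ^ k ≤ 1 :=
    pow_le_one₀ (Real.exp_pos _).le (Real.exp_le_one_iff.2 (by linarith))
  have : expSecondDiff k x ≤ (1 - Real.exp (-x)) ^ 2 :=
    mul_le_of_le_one_right (sq_nonneg _) hk
  exact ⟨this.trans (pow_le_pow_left₀ h0 h1 2), this.trans (pow_le_one₀ h0 h2)⟩

/-- The derivative factors through `1 - e^{-x}`, which supplies the zero at the origin, and every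
remaining term carries at least one `e^{-x}`. Both are needed for integrability and for the boundary
terms. -/
theorem abs_expSecondDiffDeriv_le (k : ℕ) {x : ℝ} (hx : 0 ≤ x) :
    |expSecondDiffDeriv k x| ≤ (k + 2) * (x * Real.exp (-x)) := by
  obtain ⟨h0, h1, h2⟩ := one_sub_exp_neg_mem hx
  set q := Real.exp (-x) with hq
  have hq0 : 0 < q := Real.exp_pos _
  have hq1 : q ≤ 1 := by linarith
  have e : expSecondDiffDeriv k x = (1 - q) * (2 * (q * q ^ k) - k * q ^ k * (1 - q)) := by
    simp only [expSecondDiffDeriv, ← exp_neg_pow]; push_cast; ring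
  have hqk : q ^ k ≤ 1 := pow_le_one₀ hq0.le hq1
  have hk : (k : ℝ) * q ^ k ≤ k * q := by
    rcases Nat.eq_zero_or_pos k with rfl | hk
    · simp
    · exact mul_le_mul_of_nonneg_left (pow_le_of_le_one hq0.le hq1 hk.ne') (Nat.cast_nonneg _)
  have hk0 : 0 ≤ (k : ℝ) * q ^ k := by positivity
  have hA : 0 ≤ q * q ^ k ∧ q * q ^ k ≤ q := ⟨by positivity, mul_le_of_le_one_right hq0.le hqk⟩
  have hBb : 0 ≤ k * q ^ k * (1 - q) ∧ k * q ^ k * (1 - q) ≤ k * q :=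
    ⟨by positivity, (mul_le_of_le_one_right hk0 h2).trans hk⟩
  rw [e, abs_mul, abs_of_nonneg h0]
  have : |2 * (q * q ^ k) - k * q ^ k * (1 - q)| ≤ (k + 2) * q := by
    rw [abs_le]; constructor <;> nlinarith
  calc (1 - q) * _ ≤ x * ((k + 2) * q) := mul_le_mul h1 this (abs_nonneg _) hx
    _ = _ := by ring

theorem continuous_expSecondDiff (k : ℕ) : Continuous (expSecondDiff k) :=
  continuous_iff_continuousAt.2 fun x => (hasDerivAt_expSecondDiff k x).continuousAt

theorem continuous_expSecondDiffDeriv (k : ℕ) : Continuous (expSecondDiffDeriv k) :=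
  continuous_iff_continuousAt.2 fun x => (hasDerivAt_expSecondDiffDeriv k x).continuousAt

theorem integrableOn_expSecondDiff_mul_rpow {β : ℝ} (hβ0 : 0 < β) (hβ2 : β < 2) (k : ℕ) :
    IntegrableOn (fun x => expSecondDiff k x * (β * x ^ (-β - 1))) (Set.Ioi 0) := by
  have hm : Measurable fun x => expSecondDiff k x * (β * x ^ (-β - 1)) :=
    (continuous_expSecondDiff k).measurable.mul
      ((measurable_id.pow_const (-β - 1)).const_mul β)
  rw [← Set.Ioc_union_Ioi_eq_Ioi zero_le_one]
  refine IntegrableOn.union ?_ ?_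
  · have h1 : IntegrableOn (fun x : ℝ => β * x ^ (1 - β)) (Set.Ioc 0 1) :=
      ((intervalIntegrable_iff_integrableOn_Ioc_of_le zero_le_one).1
        (intervalIntegral.intervalIntegrable_rpow' (by linarith))).const_mul β
    refine Integrable.mono' h1 hm.aestronglyMeasurable
      ((ae_restrict_iff' measurableSet_Ioc).2 (Eventually.of_forall fun x hx => ?_))
    have hx0 : 0 < x := hx.1
    rw [Real.norm_of_nonneg (mul_nonneg (expSecondDiff_nonneg k x) (by positivity))]
    calc expSecondDiff k x * (β * x ^ (-β - 1)) ≤ x ^ 2 * (β * x ^ (-β - 1)) :=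
          mul_le_mul_of_nonneg_right (expSecondDiff_le hx0.le).1 (by positivity)
      _ = β * (x ^ (2 : ℝ) * x ^ (-β - 1)) := by rw [Real.rpow_two]; ring
      _ = β * x ^ (1 - β) := by rw [← Real.rpow_add hx0]; ring_nf
  · have h1 : IntegrableOn (fun x : ℝ => β * x ^ (-β - 1)) (Set.Ioi 1) :=
      (integrableOn_Ioi_rpow_of_lt (by linarith) one_pos).const_mul β
    refine Integrable.mono' h1 hm.aestronglyMeasurable
      ((ae_restrict_iff' measurableSet_Ioi).2 (Eventually.of_forall fun x hx => ?_))
    have hx0 : 0 < x := lt_trans one_pos hx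
    rw [Real.norm_of_nonneg (mul_nonneg (expSecondDiff_nonneg k x) (by positivity))]
    exact mul_le_of_le_one_left (by positivity) (expSecondDiff_le hx0.le).2

theorem abs_expSecondDiffDeriv_mul_rpow_le (k : ℕ) (c : ℝ) {x : ℝ} (hx : 0 < x) :
    |expSecondDiffDeriv k x * x ^ c| ≤ (k + 2) * (x ^ (c + 1) * Real.exp (-x)) := by
  rw [abs_mul, abs_of_nonneg (Real.rpow_nonneg hx.le c), Real.rpow_add_one hx.ne']
  calc _ ≤ (k + 2) * (x * Real.exp (-x)) * x ^ c :=
        mul_le_mul_of_nonneg_right (abs_expSecondDiffDeriv_le k hx.le) (by positivity)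
    _ = _ := by ring

theorem integrableOn_expSecondDiffDeriv_mul_rpow {β : ℝ} (hβ2 : β < 2) (k : ℕ) :
    IntegrableOn (fun x => expSecondDiffDeriv k x * x ^ (-β)) (Set.Ioi 0) := by
  have h1 : IntegrableOn (fun x : ℝ => (k + 2) * (x ^ (-β + 1) * Real.exp (-x))) (Set.Ioi 0) := by
    have := integrableOn_rpow_mul_exp_neg_rpow (p := 1) (s := -β + 1) (by linarith) one_pos
    simp only [Real.rpow_one] at this
    exact Integrable.const_mul this _
  refine Integrable.mono' h1 ((continuous_expSecondDiffDeriv k).measurable.mul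
      (measurable_id.pow_const (-β))).aestronglyMeasurable
      ((ae_restrict_iff' measurableSet_Ioi).2 (Eventually.of_forall fun x hx => ?_))
  exact abs_expSecondDiffDeriv_mul_rpow_le k (-β) hx

theorem tendsto_rpow_nhdsGT_zero {c : ℝ} (hc : 0 < c) :
    Tendsto (fun x : ℝ => x ^ c) (𝓝[>] 0) (𝓝 0) := by
  have := (Real.continuous_rpow_const hc.le).tendsto (0 : ℝ)
  rw [Real.zero_rpow hc.ne'] at this
  exact this.mono_left nhdsWithin_le_nhds

/-- Integration by parts against `-x ^ (-β)`. The boundary terms vanish at `0` by the bound `x ^ 2`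
and `β < 2`, and at infinity by the bound `1` and `β > 0`. -/
theorem integral_expSecondDiff_eq_integral_deriv {β : ℝ} (hβ0 : 0 < β) (hβ2 : β < 2) (k : ℕ) :
    ∫ x in Set.Ioi (0 : ℝ), expSecondDiff k x * (β * x ^ (-β - 1)) =
      ∫ x in Set.Ioi (0 : ℝ), expSecondDiffDeriv k x * x ^ (-β) := by
  have h := integral_Ioi_mul_deriv_eq_deriv_mul (a := 0) (a' := 0) (b' := 0)
    (u := expSecondDiff k) (u' := expSecondDiffDeriv k) (v := fun x : ℝ => -x ^ (-β))
    (v' := fun x => β * x ^ (-β - 1))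
    (fun x _ => hasDerivAt_expSecondDiff k x)
    (fun x hx => by
      have := (Real.hasDerivAt_rpow_const (p := -β) (Or.inl (ne_of_gt hx))).neg
      exact this.congr_deriv (by ring))
    (integrableOn_expSecondDiff_mul_rpow hβ0 hβ2 k)
    (by
      have := (integrableOn_expSecondDiffDeriv_mul_rpow hβ2 k).neg
      refine this.congr_fun (fun x _ => ?_) measurableSet_Ioi
      simp)
    (by
      refine squeeze_zero_norm' ?_ (tendsto_rpow_nhdsGT_zero (c := 2 - β) (by linarith))
      filter_upwards [self_mem_nhdsWithin] with x hx
      have hx0 : 0 < x := hx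
      simp only [Pi.mul_apply, norm_mul, norm_neg]
      rw [Real.norm_of_nonneg (expSecondDiff_nonneg k x), Real.norm_of_nonneg (by positivity)]
      calc _ ≤ x ^ 2 * x ^ (-β) :=
            mul_le_mul_of_nonneg_right (expSecondDiff_le hx0.le).1 (by positivity)
        _ = x ^ (2 : ℝ) * x ^ (-β) := by rw [Real.rpow_two]
        _ = x ^ (2 - β) := by rw [← Real.rpow_add hx0]; ring_nf)
    (by
      refine squeeze_zero_norm' ?_ (tendsto_rpow_neg_atTop hβ0)
      filter_upwards [eventually_gt_atTop (0 : ℝ)] with x hx0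
      simp only [Pi.mul_apply, norm_mul, norm_neg]
      rw [Real.norm_of_nonneg (expSecondDiff_nonneg k x), Real.norm_of_nonneg (by positivity)]
      exact mul_le_of_le_one_left (by positivity) (expSecondDiff_le hx0.le).2)
  rw [h, sub_zero, zero_sub, ← integral_neg]
  congr 1; funext x; ring

/-- For `β > 1` the power `x ^ (-β)` is not integrable at `0`, so the exponentials cannot yet be
integrated one by one. A second integration by parts raises the exponent to `1 - β > -1`, where each
term is a Gamma integral. -/
theorem integral_expSecondDiffDeriv_eq_integral_derivTwo {β : ℝ} (hβ1 : 1 < β) (hβ2 : β < 2)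
    (k : ℕ) :
    ∫ x in Set.Ioi (0 : ℝ), expSecondDiffDeriv k x * x ^ (-β) =
      (β - 1)⁻¹ * ∫ x in Set.Ioi (0 : ℝ), expSecondDiffDerivTwo k x * x ^ (1 - β) := by
  have hb : β - 1 ≠ 0 := by linarith
  have hi : ∀ j : ℕ, IntegrableOn
      (fun x : ℝ => (j : ℝ) ^ 2 * (x ^ (2 - β - 1) * Real.exp (-(j * x)))) (Set.Ioi 0) :=
    integrableOn_pow_mul_rpow_mul_exp_neg (by linarith) two_ne_zero
  have h := integral_Ioi_mul_deriv_eq_deriv_mul (a := 0) (a' := 0) (b' := 0)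
    (u := expSecondDiffDeriv k) (u' := expSecondDiffDerivTwo k)
    (v := fun x : ℝ => (1 - β)⁻¹ * x ^ (1 - β)) (v' := fun x => x ^ (-β))
    (fun x _ => hasDerivAt_expSecondDiffDeriv k x)
    (fun x hx => by
      have := (Real.hasDerivAt_rpow_const (p := 1 - β) (Or.inl (ne_of_gt hx))).const_mul (1 - β)⁻¹
      convert this using 1
      have : (1 - β) ≠ 0 := by intro h; apply hb; linarith
      field_simp
      congr 1; ring)
    (integrableOn_expSecondDiffDeriv_mul_rpow hβ2 k)
    (by
      have := ((((hi k).sub ((hi (k + 1)).const_mul 2)).add (hi (k + 2))).const_mul (1 - β)⁻¹)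
      refine IntegrableOn.congr_fun this (fun x _ => ?_) measurableSet_Ioi
      have e : 2 - β - 1 = 1 - β := by ring
      simp only [Pi.add_apply, Pi.sub_apply, Pi.mul_apply, expSecondDiffDerivTwo, e]
      ring)
    (by
      have hz : Tendsto (fun x : ℝ => |(1 - β)⁻¹| * ((k + 2) * (x ^ (2 - β)))) (𝓝[>] 0) (𝓝 0) := by
        simpa using ((tendsto_rpow_nhdsGT_zero (c := 2 - β) (by linarith)).const_mul
          ((k : ℝ) + 2)).const_mul |(1 - β)⁻¹|
      refine squeeze_zero_norm' ?_ hz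
      filter_upwards [self_mem_nhdsWithin] with x hx
      have hx0 : 0 < x := hx
      have hb := abs_expSecondDiffDeriv_mul_rpow_le k (1 - β) hx0
      have e : 1 - β + 1 = 2 - β := by ring
      rw [e] at hb
      have e2 : (expSecondDiffDeriv k * fun x : ℝ => (1 - β)⁻¹ * x ^ (1 - β)) x =
        (1 - β)⁻¹ * (expSecondDiffDeriv k x * x ^ (1 - β)) := by simp only [Pi.mul_apply]; ring
      rw [e2, norm_mul, Real.norm_eq_abs, Real.norm_eq_abs]
      refine mul_le_mul_of_nonneg_left (hb.trans ?_) (abs_nonneg _)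
      refine mul_le_mul_of_nonneg_left ?_ (by positivity)
      exact mul_le_of_le_one_right (by positivity) (Real.exp_le_one_iff.2 (by linarith)))
    (by
      have hz : Tendsto (fun x : ℝ => |(1 - β)⁻¹| * ((k + 2) * (x ^ (2 - β) * Real.exp (-x))))
          atTop (𝓝 0) := by
        have := tendsto_rpow_mul_exp_neg_mul_atTop_nhds_zero (2 - β) 1 one_pos
        simpa using (this.const_mul ((k : ℝ) + 2)).const_mul |(1 - β)⁻¹|
      refine squeeze_zero_norm' ?_ hz
      filter_upwards [eventually_gt_atTop (0 : ℝ)] with x hx0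
      have hb := abs_expSecondDiffDeriv_mul_rpow_le k (1 - β) hx0
      have e : 1 - β + 1 = 2 - β := by ring
      rw [e] at hb
      have e2 : (expSecondDiffDeriv k * fun x : ℝ => (1 - β)⁻¹ * x ^ (1 - β)) x =
        (1 - β)⁻¹ * (expSecondDiffDeriv k x * x ^ (1 - β)) := by simp only [Pi.mul_apply]; ring
      rw [e2, norm_mul, Real.norm_eq_abs, Real.norm_eq_abs]
      exact mul_le_mul_of_nonneg_left hb (abs_nonneg _))
  rw [h, sub_zero, zero_sub, ← integral_neg, ← integral_const_mul]
  congr 1; funext x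
  have : (1 - β)⁻¹ = -(β - 1)⁻¹ := by rw [← inv_neg]; congr 1; ring
  rw [this]; ring

/-- The second-difference form of the Gamma integral `∫ (1 - e^{-λx}) β x^{-β-1} dx`, valid for
all `β ∈ (0, 2)`, `β ≠ 1`. -/
theorem integral_expSecondDiff_mul_rpow {β : ℝ} (hβ0 : 0 < β) (hβ2 : β < 2) (hβ1 : β ≠ 1)
    (k : ℕ) :
    ∫ x in Set.Ioi (0 : ℝ), expSecondDiff k x * (β * x ^ (-β - 1)) =
      -Real.Gamma (1 - β) * (k : ℝ) ^ β - 2 * (-Real.Gamma (1 - β) * ((k + 1 : ℕ) : ℝ) ^ β)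
        + -Real.Gamma (1 - β) * ((k + 2 : ℕ) : ℝ) ^ β := by
  rw [integral_expSecondDiff_eq_integral_deriv hβ0 hβ2]
  rcases lt_or_gt_of_ne hβ1 with h | h
  · have hi : ∀ j : ℕ, IntegrableOn
        (fun x : ℝ => (j : ℝ) ^ 1 * (x ^ (1 - β - 1) * Real.exp (-(j * x)))) (Set.Ioi 0) :=
      integrableOn_pow_mul_rpow_mul_exp_neg (by linarith) one_ne_zero
    have hv : ∀ j : ℕ, ∫ x in Set.Ioi (0 : ℝ),
        (j : ℝ) ^ 1 * (x ^ (1 - β - 1) * Real.exp (-(j * x))) =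
          Real.Gamma (1 - β) * (j : ℝ) ^ β := fun j => by
      have := integral_pow_mul_rpow_mul_exp_neg (a := 1 - β) (p := 1) (by linarith) one_ne_zero
        (by push_cast; linarith) j
      rw [this]; congr 2; push_cast; ring
    have e : ∀ x : ℝ, expSecondDiffDeriv k x * x ^ (-β) =
        2 * (((k + 1 : ℕ) : ℝ) ^ 1 * (x ^ (1 - β - 1) * Real.exp (-((k + 1 : ℕ) * x))))
        - (k : ℝ) ^ 1 * (x ^ (1 - β - 1) * Real.exp (-(k * x)))
        - ((k + 2 : ℕ) : ℝ) ^ 1 * (x ^ (1 - β - 1) * Real.exp (-((k + 2 : ℕ) * x))) := fun x => by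
      have e : 1 - β - 1 = -β := by ring
      simp only [expSecondDiffDeriv, e]; ring
    simp_rw [e]
    have hs : IntegrableOn (fun x : ℝ =>
        2 * (((k + 1 : ℕ) : ℝ) ^ 1 * (x ^ (1 - β - 1) * Real.exp (-((k + 1 : ℕ) * x))))
        - (k : ℝ) ^ 1 * (x ^ (1 - β - 1) * Real.exp (-(k * x)))) (Set.Ioi 0) :=
      ((hi (k + 1)).const_mul 2).sub (hi k)
    rw [integral_sub hs (hi (k + 2)), integral_sub ((hi (k + 1)).const_mul 2) (hi k), integral_const_mul, hv, hv, hv]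
    ring
  · have hi : ∀ j : ℕ, IntegrableOn
        (fun x : ℝ => (j : ℝ) ^ 2 * (x ^ (2 - β - 1) * Real.exp (-(j * x)))) (Set.Ioi 0) :=
      integrableOn_pow_mul_rpow_mul_exp_neg (by linarith) two_ne_zero
    have hv : ∀ j : ℕ, ∫ x in Set.Ioi (0 : ℝ),
        (j : ℝ) ^ 2 * (x ^ (2 - β - 1) * Real.exp (-(j * x))) =
          Real.Gamma (2 - β) * (j : ℝ) ^ β := fun j => by
      have := integral_pow_mul_rpow_mul_exp_neg (a := 2 - β) (p := 2) (by linarith) two_ne_zero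
        (by push_cast; linarith) j
      rw [this]; congr 2; push_cast; ring
    have e : ∀ x : ℝ, expSecondDiffDerivTwo k x * x ^ (1 - β) =
        (k : ℝ) ^ 2 * (x ^ (2 - β - 1) * Real.exp (-(k * x)))
        - 2 * (((k + 1 : ℕ) : ℝ) ^ 2 * (x ^ (2 - β - 1) * Real.exp (-((k + 1 : ℕ) * x))))
        + ((k + 2 : ℕ) : ℝ) ^ 2 * (x ^ (2 - β - 1) * Real.exp (-((k + 2 : ℕ) * x))) := fun x => by
      have e : 2 - β - 1 = 1 - β := by ring
      simp only [expSecondDiffDerivTwo, e]; ring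
    -- The factor `1 - β` cancels `(β - 1)⁻¹` up to sign, giving the same formula as in the case `β
    -- < 1`.
    have hG : Real.Gamma (2 - β) = (1 - β) * Real.Gamma (1 - β) := by
      rw [← Real.Gamma_add_one (by linarith : (1 - β) ≠ 0)]; congr 1; ring
    rw [integral_expSecondDiffDeriv_eq_integral_derivTwo h hβ2]
    simp_rw [e]
    have hs : IntegrableOn (fun x : ℝ => (k : ℝ) ^ 2 * (x ^ (2 - β - 1) * Real.exp (-(k * x)))
        - 2 * (((k + 1 : ℕ) : ℝ) ^ 2 * (x ^ (2 - β - 1) * Real.exp (-((k + 1 : ℕ) * x)))))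
        (Set.Ioi 0) := (hi k).sub ((hi (k + 1)).const_mul 2)
    rw [integral_add hs (hi (k + 2)), integral_sub (hi k) ((hi (k + 1)).const_mul 2), hv k,
      integral_const_mul, hv, hv, hG]
    have hb : β - 1 ≠ 0 := by linarith
    field_simp
    ring

/-! ### Ramp test functions and the Tauberian theorem -/

/-- The continuous ramp equal to `1` on `(-∞, r]` and to `0` on `[R, ∞)`. -/
noncomputable def ramp (r R u : ℝ) : ℝ := max 0 (min 1 ((R - u) / (R - r)))

theorem ramp_nonneg (r R u : ℝ) : 0 ≤ ramp r R u := le_max_left _ _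

theorem ramp_le_one (r R u : ℝ) : ramp r R u ≤ 1 := max_le zero_le_one (min_le_left _ _)

theorem continuous_ramp (r R : ℝ) : Continuous (ramp r R) := by
  unfold ramp; fun_prop

theorem ramp_eq_zero {r R u : ℝ} (h : r < R) (hu : R ≤ u) : ramp r R u = 0 :=
  max_eq_left ((min_le_right _ _).trans
    (div_nonpos_of_nonpos_of_nonneg (by linarith) (by linarith)))

theorem ramp_eq_one {r R u : ℝ} (h : r < R) (hu : u ≤ r) : ramp r R u = 1 := by
  have : 1 ≤ (R - u) / (R - r) := (one_le_div (by linarith)).2 (by linarith)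
  rw [ramp, min_eq_left this, max_eq_right zero_le_one]

/-- A ramp vanishing from `R < 1` on can be divided by `(1 - u) ^ 2`: replacing `1 - u` by its
maximum with `1 - R` avoids the singularity and changes nothing where the ramp is nonzero. -/
theorem exists_bounded_continuous_sq_mul_eq_ramp {r R : ℝ} (h : r < R) (hR : R < 1) :
    ∃ (f : ℝ → ℝ) (B : ℝ), Continuous f ∧ (∀ x, |f x| ≤ B) ∧
      ∀ u, (1 - u) ^ 2 * f u = ramp r R u := by
  have hpos : ∀ u : ℝ, 1 - R ≤ max (1 - u) (1 - R) := fun u => le_max_right _ _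
  have hR0 : 0 < 1 - R := by linarith
  have hpos' : ∀ u : ℝ, 0 < max (1 - u) (1 - R) := fun u => lt_of_lt_of_le hR0 (hpos u)
  refine ⟨fun u => ramp r R u / (max (1 - u) (1 - R)) ^ 2, 1 / (1 - R) ^ 2, ?_, ?_, ?_⟩
  · exact (continuous_ramp r R).div (by fun_prop) fun u => (pow_pos (hpos' u) 2).ne'
  · intro u
    rw [abs_of_nonneg (div_nonneg (ramp_nonneg _ _ _) (sq_nonneg _))]
    exact div_le_div₀ zero_le_one (ramp_le_one _ _ _) (by positivity)
      (pow_le_pow_left₀ hR0.le (hpos u) 2)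
  · intro u
    rcases le_total u R with hu | hu
    · have h1 : max (1 - u) (1 - R) = 1 - u := max_eq_left (by linarith)
      have h2 : (1 - u) ^ 2 ≠ 0 := pow_ne_zero 2 (by linarith)
      simp only [h1]
      exact mul_div_cancel₀ _ h2
    · simp [ramp_eq_zero h hu]

section Tauberian

variable {Ω : ℕ → Type*} [∀ n, MeasurableSpace (Ω n)] {P : ∀ n, Measure (Ω n)}
  {T : ∀ n, Ω n → ℝ} {δ : ℕ → ℝ} {β : ℝ}

/-- The weight `(1 - U)² / δ` has as its `k`-th moment the second difference of the given transforms
at `k`, `k + 1`, `k + 2`; the constant `1` subtracted in `hlim` drops out of it. -/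
theorem tendsto_integral_ramp_div (hT : ∀ n, Measurable (T n)) (hδ : ∀ᶠ n in atTop, 0 < δ n)
    (hβ0 : 0 < β) (hβ2 : β < 2) (hβ1 : β ≠ 1)
    (hint : ∀ᶠ n in atTop, ∀ k : ℕ, Integrable (fun ω => Real.exp (-(k * T n ω))) (P n))
    (hlim : ∀ k : ℕ, Tendsto (fun n => ((∫ ω, Real.exp (-(k * T n ω)) ∂(P n)) - 1) / δ n) atTop
      (𝓝 (-Real.Gamma (1 - β) * (k : ℝ) ^ β))) {r R : ℝ} (h : r < R) (hR : R < 1) :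
    Tendsto (fun n => (∫ ω, ramp r R (Real.exp (-T n ω)) ∂(P n)) / δ n) atTop
      (𝓝 (∫ x in Set.Ioi (0 : ℝ), ramp r R (Real.exp (-x)) * (β * x ^ (-β - 1)))) := by
  obtain ⟨f, B, hf, hB, hfr⟩ := exists_bounded_continuous_sq_mul_eq_ramp h hR
  have hw : ∀ n (k : ℕ) ω, (1 - Real.exp (-T n ω)) ^ 2 / δ n * Real.exp (-T n ω) ^ k =
      (δ n)⁻¹ * (Real.exp (-(k * T n ω)) - 2 * Real.exp (-((k + 1 : ℕ) * T n ω))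
      + Real.exp (-((k + 2 : ℕ) * T n ω))) := fun n k ω => by
    rw [← expSecondDiff_eq, expSecondDiff]; ring
  have hint' : ∀ᶠ n in atTop, ∀ k : ℕ, Integrable
      (fun ω => (1 - Real.exp (-T n ω)) ^ 2 / δ n * Real.exp (-T n ω) ^ k) (P n) := by
    filter_upwards [hint] with n hn k
    simp_rw [hw]
    exact (((hn k).sub ((hn (k + 1)).const_mul 2)).add (hn (k + 2))).const_mul _
  have key := tendsto_integral_comp_of_tendsto_moments (P := P)
    (U := fun n ω => Real.exp (-T n ω)) (w := fun n ω => (1 - Real.exp (-T n ω)) ^ 2 / δ n)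
    (ν := volume.restrict (Set.Ioi (0 : ℝ))) (V := fun x => Real.exp (-x))
    (v := fun x => expSecondDiff 0 x * (β * x ^ (-β - 1)))
    (fun n => (hT n).neg.exp) (fun n ω => (Real.exp_pos _).le)
    (hδ.mono fun n hn ω => by positivity) hint' (measurable_id.neg.exp)
    ((ae_restrict_iff' measurableSet_Ioi).2 (Eventually.of_forall fun x hx =>
      ⟨(Real.exp_pos _).le, Real.exp_le_one_iff.2 (by have : 0 < x := hx
                                                      linarith)⟩))
    ((ae_restrict_iff' measurableSet_Ioi).2 (Eventually.of_forall fun x hx => by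
      have hx0 : 0 < x := hx
      exact mul_nonneg (expSecondDiff_nonneg _ _) (by positivity)))
    (integrableOn_expSecondDiff_mul_rpow hβ0 hβ2 0)
    (fun k => by
      have e : ∀ x : ℝ, expSecondDiff 0 x * (β * x ^ (-β - 1)) * Real.exp (-x) ^ k =
          expSecondDiff k x * (β * x ^ (-β - 1)) := fun x => by
        simp only [expSecondDiff]; ring
      simp_rw [e]
      rw [integral_expSecondDiff_mul_rpow hβ0 hβ2 hβ1]
      refine (((hlim k).sub ((hlim (k + 1)).const_mul 2)).add (hlim (k + 2))).congr' ?_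
      filter_upwards [hint] with n hn
      simp_rw [hw]
      have hs : Integrable (fun ω => Real.exp (-(k * T n ω))
          - 2 * Real.exp (-((k + 1 : ℕ) * T n ω))) (P n) := (hn k).sub ((hn (k + 1)).const_mul 2)
      rw [integral_const_mul, integral_add hs (hn (k + 2)),
        integral_sub (hn k) ((hn (k + 1)).const_mul 2), integral_const_mul]
      ring)
    hf hB
  have e1 : ∀ n, ∫ ω, (1 - Real.exp (-T n ω)) ^ 2 / δ n * f (Real.exp (-T n ω)) ∂(P n) =
      (∫ ω, ramp r R (Real.exp (-T n ω)) ∂(P n)) / δ n := fun n => by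
    rw [← integral_div]
    congr 1; funext ω; rw [← hfr]; ring
  have e2 : ∀ x : ℝ, expSecondDiff 0 x * (β * x ^ (-β - 1)) * f (Real.exp (-x)) =
      ramp r R (Real.exp (-x)) * (β * x ^ (-β - 1)) := fun x => by
    rw [← hfr]; simp only [expSecondDiff]; ring
  simpa only [e1, e2] using key

theorem integral_Ioi_rpow_density (hβ0 : 0 < β) {y : ℝ} (hy : 0 < y) :
    ∫ x in Set.Ioi y, β * x ^ (-β - 1) = y ^ (-β) := by
  rw [integral_const_mul, integral_Ioi_rpow_of_lt (by linarith) hy]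
  have : -β - 1 + 1 = -β := by ring
  rw [this]; field_simp

theorem integrableOn_ramp_mul_rpow (hβ0 : 0 < β) {y z : ℝ} (hy : 0 < y) (hyz : y < z) :
    IntegrableOn (fun x => ramp (Real.exp (-z)) (Real.exp (-y)) (Real.exp (-x)) *
      (β * x ^ (-β - 1))) (Set.Ioi 0) := by
  have hexp : Real.exp (-z) < Real.exp (-y) := Real.exp_lt_exp.2 (by linarith)
  have h1 : IntegrableOn (fun x : ℝ => β * x ^ (-β - 1)) (Set.Ioi y) :=
    (integrableOn_Ioi_rpow_of_lt (by linarith) hy).const_mul β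
  rw [← Set.Ioc_union_Ioi_eq_Ioi hy.le]
  refine IntegrableOn.union ?_ ?_
  · refine integrableOn_zero.congr_fun (fun x hx => ?_) measurableSet_Ioc
    rw [ramp_eq_zero hexp (Real.exp_le_exp.2 (by linarith [hx.2])), zero_mul]
  · refine Integrable.bdd_mul h1 (c := 1)
      ((continuous_ramp _ _).comp (Real.continuous_exp.comp continuous_neg)).aestronglyMeasurable
      (Eventually.of_forall fun x => ?_)
    rw [Real.norm_of_nonneg (ramp_nonneg _ _ _)]
    exact ramp_le_one _ _ _

/-- In the variable `x`, the ramp lies between the indicators of `x > z` and of `x > y`, whose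
integrals are explicit. -/
theorem integral_ramp_mul_rpow_bounds (hβ0 : 0 < β) {y z : ℝ} (hy : 0 < y) (hyz : y < z) :
    z ^ (-β) ≤ ∫ x in Set.Ioi (0 : ℝ), ramp (Real.exp (-z)) (Real.exp (-y)) (Real.exp (-x)) *
      (β * x ^ (-β - 1)) ∧
    ∫ x in Set.Ioi (0 : ℝ), ramp (Real.exp (-z)) (Real.exp (-y)) (Real.exp (-x)) *
      (β * x ^ (-β - 1)) ≤ y ^ (-β) := by
  have hexp : Real.exp (-z) < Real.exp (-y) := Real.exp_lt_exp.2 (by linarith)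
  have hi := integrableOn_ramp_mul_rpow hβ0 hy hyz
  have hz : 0 < z := hy.trans hyz
  have hn : ∀ x : ℝ, 0 < x → 0 ≤ β * x ^ (-β - 1) := fun x hx => by positivity
  constructor
  · rw [← integral_Ioi_rpow_density hβ0 hz]
    refine le_trans (le_of_eq (setIntegral_congr_fun measurableSet_Ioi fun x hx => ?_))
      (setIntegral_mono_set hi ((ae_restrict_iff' measurableSet_Ioi).2
        (Eventually.of_forall fun x hx => mul_nonneg (ramp_nonneg _ _ _) (hn x hx)))
        (Eventually.of_forall (Set.Ioi_subset_Ioi hz.le)))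
    rw [ramp_eq_one hexp (Real.exp_le_exp.2 (by have : z < x := hx
                                                linarith)), one_mul]
  · rw [← integral_Ioi_rpow_density hβ0 hy]
    have hsplit : ∫ x in Set.Ioi (0 : ℝ), ramp (Real.exp (-z)) (Real.exp (-y)) (Real.exp (-x)) *
        (β * x ^ (-β - 1)) = ∫ x in Set.Ioi y,
          ramp (Real.exp (-z)) (Real.exp (-y)) (Real.exp (-x)) * (β * x ^ (-β - 1)) := by
      refine setIntegral_eq_of_subset_of_forall_sdiff_eq_zero measurableSet_Ioi
        (Set.Ioi_subset_Ioi hy.le) fun x hx => ?_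
      have : x ≤ y := not_lt.1 hx.2
      rw [ramp_eq_zero hexp (Real.exp_le_exp.2 (by linarith)), zero_mul]
    rw [hsplit]
    refine setIntegral_mono_on (hi.mono_set (Set.Ioi_subset_Ioi hy.le))
      ((integrableOn_Ioi_rpow_of_lt (by linarith) hy).const_mul β) measurableSet_Ioi fun x hx => ?_
    exact mul_le_of_le_one_left (hn x (hy.trans hx)) (ramp_le_one _ _ _)

/-- A Tauberian theorem: if `(E[e^{-kT_n}] - 1) / δ_n → -Γ(1-β) k^β` for all natural `k`, then
`P[T_n > 1] / δ_n → 1`. -/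
theorem tendsto_measureReal_one_lt_div [∀ n, IsProbabilityMeasure (P n)]
    (hT : ∀ n, Measurable (T n))
    (hδ : ∀ᶠ n in atTop, 0 < δ n) (hβ0 : 0 < β) (hβ2 : β < 2) (hβ1 : β ≠ 1)
    (hint : ∀ᶠ n in atTop, ∀ k : ℕ, Integrable (fun ω => Real.exp (-(k * T n ω))) (P n))
    (hlim : ∀ k : ℕ, Tendsto (fun n => ((∫ ω, Real.exp (-(k * T n ω)) ∂(P n)) - 1) / δ n) atTop
      (𝓝 (-Real.Gamma (1 - β) * (k : ℝ) ^ β))) :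
    Tendsto (fun n => (P n).real {ω | 1 < T n ω} / δ n) atTop (𝓝 1) := by
  have hlimramp : ∀ y z : ℝ, 0 < y → y < z → Tendsto (fun n =>
      (∫ ω, ramp (Real.exp (-z)) (Real.exp (-y)) (Real.exp (-T n ω)) ∂(P n)) / δ n) atTop
      (𝓝 (∫ x in Set.Ioi (0 : ℝ), ramp (Real.exp (-z)) (Real.exp (-y)) (Real.exp (-x)) *
        (β * x ^ (-β - 1)))) := fun y z hy hyz =>
    tendsto_integral_ramp_div hT hδ hβ0 hβ2 hβ1 hint hlim (Real.exp_lt_exp.2 (by linarith))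
      (by rw [Real.exp_lt_one_iff]; linarith)
  have hset : ∀ n, MeasurableSet {ω | 1 < T n ω} := fun n => measurableSet_lt measurable_const (hT n)
  have hind : ∀ n, ∫ ω, Set.indicator {ω | 1 < T n ω} (fun _ => (1 : ℝ)) ω ∂(P n) =
      (P n).real {ω | 1 < T n ω} := fun n => by
    rw [integral_indicator (hset n)]; simp
  have hii : ∀ n, Integrable (Set.indicator {ω | 1 < T n ω} (fun _ => (1 : ℝ))) (P n) :=
    fun n => (integrable_const 1).indicator (hset n)
  have hri : ∀ n r R, Integrable (fun ω => ramp r R (Real.exp (-T n ω))) (P n) := fun n r R => by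
    refine Integrable.of_bound (C := 1)
      ((continuous_ramp r R).measurable.comp (hT n).neg.exp).aestronglyMeasurable
      (Eventually.of_forall fun ω => ?_)
    rw [Real.norm_of_nonneg (ramp_nonneg _ _ _)]; exact ramp_le_one _ _ _
  have hcont : Tendsto (fun z : ℝ => z ^ (-β)) (𝓝 1) (𝓝 1) := by
    simpa using (Real.continuousAt_rpow_const 1 (-β) (Or.inl one_ne_zero)).tendsto
  rw [tendsto_order]
  constructor
  · intro a ha
    have h1 : ∀ᶠ z in 𝓝[>] (1 : ℝ), a < z ^ (-β) :=
      (hcont.eventually_const_lt ha).filter_mono nhdsWithin_le_nhds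
    -- The ramp from `1` to `z` lies below the indicator of `T > 1`, and `z` near `1` costs little
    -- by continuity of `z ^ (-β)`; the upper bound uses a ramp from `y < 1` to `1`.
    obtain ⟨z, hz, hz1⟩ := (h1.and self_mem_nhdsWithin).exists
    have hlt := lt_of_lt_of_le hz (integral_ramp_mul_rpow_bounds hβ0 one_pos hz1).1
    filter_upwards [(hlimramp 1 z one_pos hz1).eventually_const_lt hlt, hδ] with n hn hδn
    refine hn.trans_le (div_le_div_of_nonneg_right ?_ hδn.le)
    rw [← hind]
    refine integral_mono (hri _ _ _) (hii n) fun ω => ?_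
    by_cases hω : 1 < T n ω
    · simpa [Set.indicator, hω] using ramp_le_one _ _ _
    · have := ramp_eq_zero (r := Real.exp (-z)) (R := Real.exp (-1)) (u := Real.exp (-T n ω))
        (Real.exp_lt_exp.2 (neg_lt_neg hz1)) (Real.exp_le_exp.2 (by linarith))
      simp [Set.indicator, hω, this]
  · intro a ha
    have h1 : ∀ᶠ y in 𝓝[<] (1 : ℝ), y ^ (-β) < a :=
      (hcont.eventually_lt_const ha).filter_mono nhdsWithin_le_nhds
    have h0 : ∀ᶠ y in 𝓝[<] (1 : ℝ), 0 < y := nhdsWithin_le_nhds (lt_mem_nhds one_pos)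
    obtain ⟨y, ⟨hy, hy0⟩, hy1⟩ := ((h1.and h0).and self_mem_nhdsWithin).exists
    have hlt := lt_of_le_of_lt (integral_ramp_mul_rpow_bounds hβ0 hy0 hy1).2 hy
    filter_upwards [(hlimramp y 1 hy0 hy1).eventually_lt_const hlt, hδ] with n hn hδn
    refine lt_of_le_of_lt (div_le_div_of_nonneg_right ?_ hδn.le) hn
    rw [← hind]
    refine integral_mono (hii n) (hri _ _ _) fun ω => ?_
    by_cases hω : 1 < T n ω
    · have := ramp_eq_one (r := Real.exp (-1)) (R := Real.exp (-y)) (u := Real.exp (-T n ω))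
        (Real.exp_lt_exp.2 (neg_lt_neg hy1)) (Real.exp_le_exp.2 (by linarith))
      simp [Set.indicator, hω, this]
    · simpa [Set.indicator, hω] using ramp_nonneg _ _ _

end Tauberian

/-! ### Linearizing a product -/

/-- On the left only products of at least two of the `a i` survive, so absolute values may be taken
and each `1 + |a i|` bounded by its exponential. The induction isolates the new cross term `a i * (p
- 1)`. -/
theorem abs_prod_one_add_sub_one_sub_sum_le {ι : Type*} (t : Finset ι) (a : ι → ℝ) :
    |∏ i ∈ t, (1 + a i) - 1 - ∑ i ∈ t, a i| ≤
      Real.exp (∑ i ∈ t, |a i|) - 1 - ∑ i ∈ t, |a i| := by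
  classical
  induction t using Finset.induction_on with
  | empty => simp
  | insert i t hi ih =>
    have h1 : |∏ j ∈ t, (1 + a j) - 1| ≤ Real.exp (∑ j ∈ t, |a j|) - 1 := by
      simpa using Finset.norm_prod_one_add_sub_one_le t a
    rw [Finset.prod_insert hi, Finset.sum_insert hi, Finset.sum_insert hi]
    set p := ∏ j ∈ t, (1 + a j)
    set S := ∑ j ∈ t, |a j|
    have e : (1 + a i) * p - 1 - (a i + ∑ j ∈ t, a j) =
      (p - 1 - ∑ j ∈ t, a j) + a i * (p - 1) := by ring
    rw [e]
    refine (abs_add_le _ _).trans ?_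
    rw [abs_mul]
    have h2 := mul_le_mul_of_nonneg_left h1 (abs_nonneg (a i))
    have h3 := Real.add_one_le_exp |a i|
    have h4 := mul_le_mul_of_nonneg_left h3 (Real.exp_pos S).le
    rw [Real.exp_add]
    nlinarith

/-! ### Integrability from regular variation with index above one -/

namespace RegVar

/-- At `Λ = 2` the limit is `2 ^ (-ρ) < 1 / 2`; any `q` strictly between bounds the ratio from some
point on, and doubling is iterated. The bound `q < 1 / 2` lets the tails beat dyadic growth. -/
theorem TailRegularlyVarying.exists_geometric_tail {Ω : Type*} [MeasurableSpace Ω]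
    {P : Measure Ω} [IsProbabilityMeasure P] {X : Ω → ℝ} {ρ : ℝ}
    (h : TailRegularlyVarying P X ρ) (hρ : 1 < ρ) :
    ∃ y q : ℝ, 0 < y ∧ 0 < q ∧ q < 1 / 2 ∧
      ∀ j : ℕ, P.real {ω | 2 ^ j * y < X ω} ≤ q ^ j := by
  have h2 : (2 : ℝ) ^ (-ρ) < 1 / 2 := by
    have : (2 : ℝ) ^ (-ρ) < 2 ^ (-1 : ℝ) := Real.rpow_lt_rpow_of_exponent_lt (by norm_num)
      (by linarith)
    rwa [Real.rpow_neg_one, ← one_div] at this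
  obtain ⟨q, hq1, hq2⟩ := exists_between h2
  have hq0 : 0 < q := lt_trans (by positivity) hq1
  obtain ⟨y, hy⟩ := eventually_atTop.1
    (((h 2 two_pos).eventually_lt_const hq1).and (eventually_gt_atTop 0))
  have hy0 : 0 < y := (hy y le_rfl).2
  have step : ∀ x, y ≤ x → P.real {ω | 2 * x < X ω} ≤ q * P.real {ω | x < X ω} := by
    intro x hx
    obtain ⟨hr, hx0⟩ := hy x hx
    -- Where the tail is already zero the quotient carries no information, and monotonicity of the
    -- tail is used instead.
    rcases (measureReal_nonneg (μ := P) (s := {ω | x < X ω})).eq_or_lt with h0 | h0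
    · have : P.real {ω | 2 * x < X ω} ≤ P.real {ω | x < X ω} :=
        measureReal_mono fun ω (hω : 2 * x < X ω) => show x < X ω by linarith
      rw [← h0] at this ⊢
      linarith
    · exact ((div_lt_iff₀ h0).1 hr).le
  refine ⟨y, q, hy0, hq0, hq2, fun j => ?_⟩
  induction j with
  | zero => simp
  | succ j ih =>
    have hge : y ≤ 2 ^ j * y := le_mul_of_one_le_left hy0.le (one_le_pow₀ (by norm_num))
    calc P.real {ω | 2 ^ (j + 1) * y < X ω} = P.real {ω | 2 * (2 ^ j * y) < X ω} := by
          congr 1; ext ω; simp only [Set.mem_ofPred_eq]; ring_nf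
      _ ≤ q * P.real {ω | 2 ^ j * y < X ω} := step _ hge
      _ ≤ q * q ^ j := mul_le_mul_of_nonneg_left ih hq0.le
      _ = q ^ (j + 1) := by ring

theorem TailRegularlyVarying.integrable {Ω : Type*} [MeasurableSpace Ω]
    {P : Measure Ω} [IsProbabilityMeasure P] {X : Ω → ℝ} {ρ : ℝ} (hX : Measurable X)
    (hX0 : ∀ᵐ ω ∂P, 0 ≤ X ω) (h : TailRegularlyVarying P X ρ) (hρ : 1 < ρ) :
    Integrable X P := by
  obtain ⟨y, q, hy, hq0, hq, hgeo⟩ := h.exists_geometric_tail hρ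
  have hset : ∀ j : ℕ, MeasurableSet {ω | 2 ^ j * y < X ω} := fun j =>
    measurableSet_lt measurable_const hX
  have hpt : ∀ ω, ENNReal.ofReal (X ω) ≤ ENNReal.ofReal (2 * y) +
      ∑' j : ℕ, Set.indicator {ω | 2 ^ j * y < X ω}
        (fun _ => ENNReal.ofReal (2 ^ j * (4 * y))) ω := by
    intro ω
    rcases le_or_gt (X ω) (2 * y) with hle | hgt
    · exact (ENNReal.ofReal_le_ofReal hle).trans le_self_add
    · obtain ⟨j, hj1, hj2⟩ := exists_nat_pow_near
        ((one_le_div (by positivity : 0 < 2 * y)).2 hgt.le) (by norm_num : (1 : ℝ) < 2)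
      rw [le_div_iff₀ (by positivity)] at hj1
      rw [div_lt_iff₀ (by positivity)] at hj2
      have hmem : ω ∈ {ω | 2 ^ j * y < X ω} := by
        have : (0 : ℝ) < 2 ^ j * y := by positivity
        show 2 ^ j * y < X ω
        nlinarith
      refine le_trans ?_ (le_trans (ENNReal.le_tsum j) le_add_self)
      rw [Set.indicator_of_mem hmem]
      refine ENNReal.ofReal_le_ofReal (hj2.le.trans (le_of_eq ?_))
      ring
  have hlin : ∫⁻ ω, ENNReal.ofReal (X ω) ∂P < ⊤ := by
    refine lt_of_le_of_lt (lintegral_mono hpt) ?_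
    rw [lintegral_add_left measurable_const, lintegral_tsum fun j =>
      (measurable_const.indicator (hset j)).aemeasurable]
    refine ENNReal.add_lt_top.2 ⟨by simp [ENNReal.mul_lt_top], ?_⟩
    have hterm : ∀ j : ℕ, ∫⁻ ω, Set.indicator {ω | 2 ^ j * y < X ω}
        (fun _ => ENNReal.ofReal (2 ^ j * (4 * y))) ω ∂P ≤
        ENNReal.ofReal (4 * y) * ENNReal.ofReal (2 * q) ^ j := fun j => by
      rw [lintegral_indicator_const (hset j), ← ofReal_measureReal,
        ← ENNReal.ofReal_mul (by positivity), ← ENNReal.ofReal_pow (by positivity),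
        ← ENNReal.ofReal_mul (by positivity)]
      refine ENNReal.ofReal_le_ofReal ?_
      calc 2 ^ j * (4 * y) * P.real {ω | 2 ^ j * y < X ω} ≤ 2 ^ j * (4 * y) * q ^ j :=
            mul_le_mul_of_nonneg_left (hgeo j) (by positivity)
        _ = 4 * y * (2 * q) ^ j := by rw [mul_pow]; ring
    refine lt_of_le_of_lt (ENNReal.tsum_le_tsum hterm) ?_
    rw [ENNReal.tsum_mul_left, ENNReal.tsum_geometric]
    refine ENNReal.mul_lt_top ENNReal.ofReal_lt_top (ENNReal.inv_lt_top.2 ?_)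
    rw [tsub_pos_iff_lt, ENNReal.ofReal_lt_one]
    linarith
  refine ⟨hX.aestronglyMeasurable, ?_⟩
  rwa [hasFiniteIntegral_iff_ofReal hX0]

end RegVar

/-! ### Laplace transform of one variable -/

section Laplace

variable {Ω : Type*} [MeasurableSpace Ω] {P : Measure Ω} {Y : Ω → ℝ}

theorem integrable_exp_neg_mul_of_bounded_below [IsProbabilityMeasure P]
    (hY : Measurable Y) {m : ℝ}
    (hm : ∀ᵐ ω ∂P, -m ≤ Y ω) {u : ℝ} (hu : 0 ≤ u) :
    Integrable (fun ω => Real.exp (-u * Y ω)) P := by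
  refine Integrable.of_bound (C := Real.exp (u * m))
    (hY.const_mul (-u)).exp.aestronglyMeasurable (hm.mono fun ω hω => ?_)
  rw [Real.norm_of_nonneg (Real.exp_pos _).le, Real.exp_le_exp]
  nlinarith

/-- The transform minus one is convex and vanishes at `0`. Convexity of `exp` is applied pointwise
between `0` and `-s Y`, so no sign or mean of `Y` is needed. -/
theorem laplace_sub_one_le_div_mul [IsProbabilityMeasure P]
    (hi : ∀ u : ℝ, 0 ≤ u → Integrable (fun ω => Real.exp (-u * Y ω)) P)
    {t s : ℝ} (ht : 0 ≤ t) (hts : t ≤ s) (hs : 0 < s) :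
    (∫ ω, Real.exp (-t * Y ω) ∂P) - 1 ≤ t / s * ((∫ ω, Real.exp (-s * Y ω) ∂P) - 1) := by
  have hd0 : 0 ≤ t / s := by positivity
  have hd1 : t / s ≤ 1 := (div_le_one hs).2 hts
  have h : ∫ ω, Real.exp (-t * Y ω) ∂P ≤
      ∫ ω, ((1 - t / s) + t / s * Real.exp (-s * Y ω)) ∂P := by
    refine integral_mono (hi t ht) ((integrable_const _).add ((hi s hs.le).const_mul _))
      fun ω => ?_
    have := convexOn_exp.2 (Set.mem_univ (0 : ℝ)) (Set.mem_univ (-s * Y ω))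
      (by linarith : 0 ≤ 1 - t / s) hd0 (by ring)
    simp only [smul_eq_mul, mul_zero, zero_add, Real.exp_zero, mul_one] at this
    have e : t / s * (-s * Y ω) = -t * Y ω := by field_simp
    rwa [e] at this
  rw [integral_add (integrable_const _) ((hi s hs.le).const_mul _), integral_const_mul] at h
  simp only [integral_const, probReal_univ, one_smul] at h
  linarith

theorem laplace_sub_one_nonpos [IsProbabilityMeasure P]
    (hY : ∀ᵐ ω ∂P, 0 ≤ Y ω)
    (hi : ∀ u : ℝ, 0 ≤ u → Integrable (fun ω => Real.exp (-u * Y ω)) P) {u : ℝ} (hu : 0 ≤ u) :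
    (∫ ω, Real.exp (-u * Y ω) ∂P) - 1 ≤ 0 := by
  have h : ∫ ω, Real.exp (-u * Y ω) ∂P ≤ ∫ _, (1 : ℝ) ∂P := by
    refine integral_mono_ae (hi u hu) (integrable_const _) (hY.mono fun ω hω => ?_)
    exact Real.exp_le_one_iff.2 (by nlinarith)
  simp only [integral_const, probReal_univ, one_smul] at h
  linarith

theorem laplace_antitone (hY : ∀ᵐ ω ∂P, 0 ≤ Y ω)
    (hi : ∀ u : ℝ, 0 ≤ u → Integrable (fun ω => Real.exp (-u * Y ω)) P) {t s : ℝ} (ht : 0 ≤ t)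
    (hts : t ≤ s) : ∫ ω, Real.exp (-s * Y ω) ∂P ≤ ∫ ω, Real.exp (-t * Y ω) ∂P := by
  refine integral_mono_ae (hi s (ht.trans hts)) (hi t ht) (hY.mono fun ω hω => ?_)
  exact Real.exp_le_exp.2 (by nlinarith)

theorem laplace_sub_one_nonneg [IsProbabilityMeasure P]
    (hYi : Integrable Y P) (hY0 : ∫ ω, Y ω ∂P = 0)
    (hi : ∀ u : ℝ, 0 ≤ u → Integrable (fun ω => Real.exp (-u * Y ω)) P) {u : ℝ} (hu : 0 ≤ u) :
    0 ≤ (∫ ω, Real.exp (-u * Y ω) ∂P) - 1 := by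
  have h : ∫ ω, (-u * Y ω + 1) ∂P ≤ ∫ ω, Real.exp (-u * Y ω) ∂P :=
    integral_mono ((hYi.const_mul _).add (integrable_const _)) (hi u hu)
      fun ω => Real.add_one_le_exp _
  rw [integral_add (hYi.const_mul _) (integrable_const _), integral_const_mul, hY0] at h
  simp only [integral_const, probReal_univ, one_smul] at h
  linarith

end Laplace

/-! ### Row sums: signs, monotonicity and the product formula -/

namespace RegVar

section Row

variable {Ω : ℕ → Type*} [∀ n, MeasurableSpace (Ω n)] {P : ∀ n, Measure (Ω n)}
  {X : ∀ n, Fin n → Ω n → ℝ} {βi : ∀ n, Fin n → ℝ} {n : ℕ}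

theorem one_lt_index_of_not_minIndex_lt (hβi : ∀ n k, 0 < βi n k ∧ βi n k < 2 ∧ βi n k ≠ 1)
    (h : ¬ minIndex βi n < 1) (k : Fin n) : 1 < βi n k := by
  have h1 : minIndex βi n ≤ βi n k := ciInf_le (Set.finite_range _).bddBelow k
  exact lt_of_le_of_ne ((not_lt.1 h).trans h1) (hβi n k).2.2.symm

theorem entryCentering_of_lt (h : minIndex βi n < 1) (k : Fin n) :
    entryCentering P X βi n k = 0 := if_pos h

theorem entryCentering_of_not_lt (h : ¬ minIndex βi n < 1) (k : Fin n) :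
    entryCentering P X βi n k = ∫ ω, X n k ω ∂(P n) := if_neg h

theorem centering_eq_sum (hint : ¬ minIndex βi n < 1 → ∀ k, Integrable (X n k) (P n)) :
    centering P X βi n = ∑ k, entryCentering P X βi n k := by
  by_cases h : minIndex βi n < 1
  · simp [centering, h, entryCentering_of_lt h]
  · simp only [centering, h, if_false, entryCentering_of_not_lt h, rowSum]
    exact integral_finsetSum _ fun k _ => hint h k

theorem rowSum_sub_centering (hint : ¬ minIndex βi n < 1 → ∀ k, Integrable (X n k) (P n))
    (ω : Ω n) : rowSum X n ω - centering P X βi n =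
      ∑ k, (X n k ω - entryCentering P X βi n k) := by
  rw [centering_eq_sum hint, rowSum, Finset.sum_sub_distrib]

theorem integral_exp_rowSum (hmeas : ∀ n k, Measurable (X n k))
    (hindep : iIndepFun (X n) (P n))
    (hint : ¬ minIndex βi n < 1 → ∀ k, Integrable (X n k) (P n)) (u : ℝ) :
    ∫ ω, Real.exp (-u * (rowSum X n ω - centering P X βi n)) ∂(P n) =
      ∏ k, (1 + transformDeviation P X βi n k u) := by
  simp_rw [rowSum_sub_centering hint, Finset.mul_sum, Real.exp_sum]
  rw [hindep.integral_fun_prod_comp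
    (f := fun k x => Real.exp (-u * (x - entryCentering P X βi n k)))
    (fun k => (hmeas n k).aemeasurable) fun k =>
      (((measurable_id.sub_const _).const_mul (-u)).exp).aestronglyMeasurable]
  simp [transformDeviation]

variable [∀ n, IsProbabilityMeasure (P n)]

theorem integrable_exp_entry (hmeas : ∀ n k, Measurable (X n k))
    (hnonneg : ∀ n k, ∀ᵐ ω ∂(P n), 0 ≤ X n k ω) (k : Fin n) {u : ℝ} (hu : 0 ≤ u) :
    Integrable (fun ω => Real.exp (-u * (X n k ω - entryCentering P X βi n k))) (P n) :=
  integrable_exp_neg_mul_of_bounded_below ((hmeas n k).sub_const _)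
    (m := entryCentering P X βi n k) ((hnonneg n k).mono fun ω hω => by linarith) hu

theorem integrable_exp_rowSum (hmeas : ∀ n k, Measurable (X n k))
    (hnonneg : ∀ n k, ∀ᵐ ω ∂(P n), 0 ≤ X n k ω) {u : ℝ} (hu : 0 ≤ u) :
    Integrable (fun ω => Real.exp (-u * (rowSum X n ω - centering P X βi n))) (P n) := by
  have hm : Measurable (rowSum X n) := Finset.measurable_sum _ fun k _ => hmeas n k
  refine integrable_exp_neg_mul_of_bounded_below (hm.sub_const _)
    (m := centering P X βi n) ?_ hu
  filter_upwards [ae_all_iff.2 (hnonneg n)] with ω hω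
  have : 0 ≤ rowSum X n ω := Finset.sum_nonneg fun k _ => hω k
  linarith

theorem sumDeviation_le_div_mul (hmeas : ∀ n k, Measurable (X n k))
    (hnonneg : ∀ n k, ∀ᵐ ω ∂(P n), 0 ≤ X n k ω) {t s : ℝ} (ht : 0 ≤ t) (hts : t ≤ s)
    (hs : 0 < s) : sumDeviation P X βi n t ≤ t / s * sumDeviation P X βi n s := by
  rw [sumDeviation, sumDeviation, Finset.mul_sum]
  exact Finset.sum_le_sum fun k _ => laplace_sub_one_le_div_mul
    (fun u hu => integrable_exp_entry hmeas hnonneg k hu) ht hts hs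

theorem transformDeviation_nonpos (hmeas : ∀ n k, Measurable (X n k))
    (hnonneg : ∀ n k, ∀ᵐ ω ∂(P n), 0 ≤ X n k ω) (h : minIndex βi n < 1) (k : Fin n) {u : ℝ}
    (hu : 0 ≤ u) : transformDeviation P X βi n k u ≤ 0 :=
  laplace_sub_one_nonpos ((hnonneg n k).mono fun ω hω => by rwa [entryCentering_of_lt h, sub_zero])
    (fun u hu => integrable_exp_entry hmeas hnonneg k hu) hu

theorem transformDeviation_nonneg (hmeas : ∀ n k, Measurable (X n k))
    (hnonneg : ∀ n k, ∀ᵐ ω ∂(P n), 0 ≤ X n k ω)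
    (hint : ¬ minIndex βi n < 1 → ∀ k, Integrable (X n k) (P n)) (h : ¬ minIndex βi n < 1)
    (k : Fin n) {u : ℝ} (hu : 0 ≤ u) : 0 ≤ transformDeviation P X βi n k u := by
  refine laplace_sub_one_nonneg (Y := fun ω => X n k ω - entryCentering P X βi n k)
    ((hint h k).sub (integrable_const _)) ?_ (fun u hu => integrable_exp_entry hmeas hnonneg k hu) hu
  rw [integral_sub (hint h k) (integrable_const _), entryCentering_of_not_lt h]
  simp

/-- All entries of a row are centered or none is, so their deviations share one sign and nothing
cancels in the sum. -/
theorem sum_abs_transformDeviation (hmeas : ∀ n k, Measurable (X n k))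
    (hnonneg : ∀ n k, ∀ᵐ ω ∂(P n), 0 ≤ X n k ω)
    (hint : ¬ minIndex βi n < 1 → ∀ k, Integrable (X n k) (P n)) {u : ℝ} (hu : 0 ≤ u) :
    ∑ k, |transformDeviation P X βi n k u| = |sumDeviation P X βi n u| := by
  by_cases h : minIndex βi n < 1
  · have hk := fun k => transformDeviation_nonpos hmeas hnonneg h k hu
    rw [sumDeviation, abs_of_nonpos (Finset.sum_nonpos fun k _ => hk k), ← Finset.sum_neg_distrib]
    exact Finset.sum_congr rfl fun k _ => abs_of_nonpos (hk k)
  · have hk := fun k => transformDeviation_nonneg hmeas hnonneg hint h k hu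
    rw [sumDeviation, abs_of_nonneg (Finset.sum_nonneg fun k _ => hk k)]
    exact Finset.sum_congr rfl fun k _ => abs_of_nonneg (hk k)

theorem sumDeviation_nonpos (hmeas : ∀ n k, Measurable (X n k))
    (hnonneg : ∀ n k, ∀ᵐ ω ∂(P n), 0 ≤ X n k ω) (h : minIndex βi n < 1) {u : ℝ}
    (hu : 0 ≤ u) : sumDeviation P X βi n u ≤ 0 :=
  Finset.sum_nonpos fun k _ => transformDeviation_nonpos hmeas hnonneg h k hu

theorem sumDeviation_nonneg (hmeas : ∀ n k, Measurable (X n k))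
    (hnonneg : ∀ n k, ∀ᵐ ω ∂(P n), 0 ≤ X n k ω)
    (hint : ¬ minIndex βi n < 1 → ∀ k, Integrable (X n k) (P n)) (h : ¬ minIndex βi n < 1)
    {u : ℝ} (hu : 0 ≤ u) : 0 ≤ sumDeviation P X βi n u :=
  Finset.sum_nonneg fun k _ => transformDeviation_nonneg hmeas hnonneg hint h k hu

/-- Without centering each transform decreases; with centering the sum is nonnegative and convexity
gives `A(t) ≤ (t / s) A(s)`. -/
theorem abs_sumDeviation_mono (hmeas : ∀ n k, Measurable (X n k))
    (hnonneg : ∀ n k, ∀ᵐ ω ∂(P n), 0 ≤ X n k ω)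
    (hint : ¬ minIndex βi n < 1 → ∀ k, Integrable (X n k) (P n)) {t s : ℝ} (ht : 0 ≤ t)
    (hts : t ≤ s) (hs : 0 < s) :
    |sumDeviation P X βi n t| ≤ |sumDeviation P X βi n s| := by
  by_cases h : minIndex βi n < 1
  · rw [abs_of_nonpos (sumDeviation_nonpos hmeas hnonneg h ht),
      abs_of_nonpos (sumDeviation_nonpos hmeas hnonneg h hs.le), neg_le_neg_iff]
    refine Finset.sum_le_sum fun k _ => sub_le_sub_right ?_ 1
    exact laplace_antitone
      ((hnonneg n k).mono fun ω hω => by rwa [entryCentering_of_lt h, sub_zero])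
      (fun u hu => integrable_exp_entry hmeas hnonneg k hu) ht hts
  · have h0 := sumDeviation_nonneg hmeas hnonneg hint h hs.le
    rw [abs_of_nonneg (sumDeviation_nonneg hmeas hnonneg hint h ht), abs_of_nonneg h0]
    exact (sumDeviation_le_div_mul hmeas hnonneg ht hts hs).trans
      (mul_le_of_le_one_left h0 ((div_le_one hs).2 hts))

theorem abs_integral_exp_rowSum_sub_le (hmeas : ∀ n k, Measurable (X n k))
    (hnonneg : ∀ n k, ∀ᵐ ω ∂(P n), 0 ≤ X n k ω) (hindep : iIndepFun (X n) (P n))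
    (hint : ¬ minIndex βi n < 1 → ∀ k, Integrable (X n k) (P n)) {u : ℝ} (hu : 0 ≤ u)
    (h1 : |sumDeviation P X βi n u| ≤ 1) :
    |(∫ ω, Real.exp (-u * (rowSum X n ω - centering P X βi n)) ∂(P n)) - 1
      - sumDeviation P X βi n u| ≤ sumDeviation P X βi n u ^ 2 := by
  rw [integral_exp_rowSum hmeas hindep hint]
  have h := abs_prod_one_add_sub_one_sub_sum_le Finset.univ
    fun k => transformDeviation P X βi n k u
  rw [sum_abs_transformDeviation hmeas hnonneg hint hu] at h
  refine h.trans ((le_abs_self _).trans ?_)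
  have := Real.abs_exp_sub_one_sub_id_le (x := |sumDeviation P X βi n u|) (by rwa [abs_abs])
  rwa [sq_abs] at this

end Row

/-! ### Asymptotics along a sequence `x n ≥ 1 / s n` -/

section Sequence

variable {Ω : ℕ → Type*} [∀ n, MeasurableSpace (Ω n)] {P : ∀ n, Measure (Ω n)}
  {X : ∀ n, Fin n → Ω n → ℝ} {βi : ∀ n, Fin n → ℝ} {β : ℝ} {L : ℕ → ℝ → ℝ} {s x : ℕ → ℝ}

theorem Gamma_one_sub_ne_zero (hβ2 : β < 2) (hβ1 : β ≠ 1) : Real.Gamma (1 - β) ≠ 0 := by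
  refine Real.Gamma_ne_zero fun m hm => ?_
  rcases Nat.eq_zero_or_pos m with rfl | hm0
  · apply hβ1; push_cast at hm; linarith
  · have : (1 : ℝ) ≤ m := by exact_mod_cast hm0
    linarith

theorem tendsto_atTop_of_one_div_le (hs_pos : ∀ n, 1 ≤ n → 0 < s n)
    (hs : Tendsto s atTop (𝓝 0)) (hx : ∀ n, 1 ≤ n → 1 / s n ≤ x n) : Tendsto x atTop atTop := by
  have hs' : Tendsto s atTop (𝓝[>] 0) := tendsto_nhdsWithin_iff.2
    ⟨hs, (eventually_ge_atTop 1).mono hs_pos⟩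
  refine tendsto_atTop_mono' _ ?_ hs'.inv_tendsto_nhdsGT_zero
  filter_upwards [eventually_ge_atTop 1] with n hn
  simpa using hx n hn

theorem eventually_normalization_pos (hL : PosSepSlowlyVarying L) (hx : Tendsto x atTop atTop) :
    ∀ᶠ n in atTop, 0 < L n (x n) * x n ^ (-β) := by
  obtain ⟨c, ℓ, -, hpos, hc, hLc⟩ := hL
  filter_upwards [hx.eventually hpos, hx.eventually_gt_atTop 0, eventually_ge_atTop 1]
    with n h1 h2 h3
  rw [hLc n h3 _ h2]
  have := hc n h3
  positivity

/-- Separability matters here: `c n` cancels, leaving a ratio of the single function `ℓ` at two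
proportional points. -/
theorem tendsto_normalization_ratio (hL : PosSepSlowlyVarying L) (hx : Tendsto x atTop atTop)
    {lam : ℝ} (hlam : 0 < lam) :
    Tendsto (fun n => |L n (1 / (lam / x n)) * (lam / x n) ^ β| / (L n (x n) * x n ^ (-β))) atTop
      (𝓝 (lam ^ β)) := by
  obtain ⟨c, ℓ, hsv, hpos, hc, hLc⟩ := hL
  have h1 := (hsv lam⁻¹ (by positivity)).comp hx
  have h2 : Tendsto (fun n => |ℓ (lam⁻¹ * x n) / ℓ (x n)| * lam ^ β) atTop (𝓝 (lam ^ β)) := by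
    simpa using h1.abs.mul_const (lam ^ β)
  refine h2.congr' ?_
  filter_upwards [hx.eventually hpos, hx.eventually_gt_atTop 0, eventually_ge_atTop 1]
    with n h1 h2 h3
  have hcn := hc n h3
  have e : 1 / (lam / x n) = lam⁻¹ * x n := by field_simp
  rw [e, hLc n h3 _ h2, hLc n h3 _ (by positivity), Real.div_rpow hlam.le h2.le,
    Real.rpow_neg h2.le, abs_mul, abs_mul, abs_div, abs_of_pos hcn, abs_of_pos h1,
    abs_of_pos (by positivity : 0 < lam ^ β / x n ^ β)]
  have : 0 < x n ^ β := by positivity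
  field_simp

/-- The uniform hypothesis is evaluated at the single point `u = lam / x n`, which is at most `lam *
s n`. -/
theorem tendsto_abs_sumDeviation_div (hβ2 : β < 2) (hβ1 : β ≠ 1)
    (hL : PosSepSlowlyVarying L) (hs_pos : ∀ n, 1 ≤ n → 0 < s n)
    (hx : ∀ n, 1 ≤ n → 1 / s n ≤ x n) (hxt : Tendsto x atTop atTop) {lam : ℝ} (hlam : 0 < lam)
    (hA : Tendsto (fun n => ⨆ u ∈ Set.Ioc 0 (lam * s n),
        ENNReal.ofReal |(|sumDeviation P X βi n u
          / (Real.Gamma (1 - β) * L n (1 / u) * u ^ β)|) - 1|) atTop (𝓝 0)) :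
    Tendsto (fun n => |sumDeviation P X βi n (lam / x n)| / (L n (x n) * x n ^ (-β))) atTop
      (𝓝 (|Real.Gamma (1 - β)| * lam ^ β)) := by
  have hG := Gamma_one_sub_ne_zero hβ2 hβ1
  set R : ℕ → ℝ := fun n => |sumDeviation P X βi n (lam / x n)
          / (Real.Gamma (1 - β) * L n (1 / (lam / x n)) * (lam / x n) ^ β)| with hR
  have hmem : ∀ᶠ n in atTop, lam / x n ∈ Set.Ioc 0 (lam * s n) := by
    filter_upwards [hxt.eventually_gt_atTop 0, eventually_ge_atTop 1] with n h1 h2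
    refine ⟨by positivity, ?_⟩
    have h3 := hx n h2
    have hsn := hs_pos n h2
    rw [div_le_iff₀ hsn] at h3
    rw [div_le_iff₀ h1]
    nlinarith
  have h0 : Tendsto (fun n => ENNReal.ofReal |R n - 1|) atTop (𝓝 0) := by
    refine tendsto_of_tendsto_of_tendsto_of_le_of_le' tendsto_const_nhds hA
      (Eventually.of_forall fun n => zero_le) ?_
    filter_upwards [hmem] with n hn
    exact le_iSup₂ (f := fun u (_ : u ∈ Set.Ioc 0 (lam * s n)) =>
      ENNReal.ofReal |(|sumDeviation P X βi n u
          / (Real.Gamma (1 - β) * L n (1 / u) * u ^ β)|) - 1|) _ hn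
  have h1 : Tendsto R atTop (𝓝 1) := by
    have := (ENNReal.tendsto_toReal ENNReal.zero_ne_top).comp h0
    simp only [Function.comp_def, ENNReal.toReal_ofReal (abs_nonneg _), ENNReal.toReal_zero] at this
    rw [tendsto_iff_dist_tendsto_zero]
    simpa only [Real.dist_eq] using this
  have h2 := (h1.mul_const |Real.Gamma (1 - β)|).mul
    (tendsto_normalization_ratio (β := β) hL hxt hlam)
  rw [one_mul] at h2
  refine h2.congr' ?_
  -- A zero denominator would make the quotient `0`, contrary to its limit `1`; thus the denominator
  -- may be cleared.
  filter_upwards [h1.eventually_const_lt zero_lt_one] with n hn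
  have hne : Real.Gamma (1 - β) * L n (1 / (lam / x n)) * (lam / x n) ^ β ≠ 0 := by
    intro h
    simp only [hR, h, div_zero, abs_zero, lt_irrefl] at hn
  have hne' : L n (1 / (lam / x n)) * (lam / x n) ^ β ≠ 0 := by
    rw [mul_assoc] at hne
    exact right_ne_zero_of_mul hne
  simp only [hR]
  rw [mul_assoc (Real.Gamma (1 - β)), abs_div, abs_mul (Real.Gamma (1 - β))]
  have hG' : |Real.Gamma (1 - β)| ≠ 0 := abs_ne_zero.2 hG
  have hne'' := abs_ne_zero.2 hne'
  set q := |L n (1 / (lam / x n)) * (lam / x n) ^ β|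
  field_simp

variable [∀ n, IsProbabilityMeasure (P n)]

/-- The normalized signed deviation converges: the centered regime is the one with `β > 1`. -/
theorem tendsto_sumDeviation_div (hmeas : ∀ n k, Measurable (X n k))
    (hnonneg : ∀ n k, ∀ᵐ ω ∂(P n), 0 ≤ X n k ω)
    (hint : ∀ n, ¬ minIndex βi n < 1 → ∀ k, Integrable (X n k) (P n))
    (hβ2 : β < 2) (hβ1 : β ≠ 1) (hxt : Tendsto x atTop atTop) {δ : ℕ → ℝ}
    (hδ : ∀ᶠ n in atTop, 0 < δ n)
    (habs : ∀ lam : ℝ, 0 < lam → Tendsto (fun n => |sumDeviation P X βi n (lam / x n)| / δ n) atTop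
      (𝓝 (|Real.Gamma (1 - β)| * lam ^ β))) {lam : ℝ} (hlam : 0 < lam) :
    Tendsto (fun n => sumDeviation P X βi n (lam / x n) / δ n) atTop
      (𝓝 (-Real.Gamma (1 - β) * lam ^ β)) := by
  have hG : 0 < |Real.Gamma (1 - β)| := abs_pos.2 (Gamma_one_sub_ne_zero hβ2 hβ1)
  -- Halving the argument tests the sign: a nonnegative `A` at most halves in absolute value, a
  -- nonpositive one at least halves, whereas the limit ratio is `(1 / 2) ^ β`. Comparison with `1 /
  -- 2` excludes the wrong regime.
  have hconv : ∀ᶠ n in atTop, sumDeviation P X βi n (1 / 2 / x n) ≤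
      1 / 2 * sumDeviation P X βi n (1 / x n) := by
    filter_upwards [hxt.eventually_gt_atTop 0] with n hn
    have := sumDeviation_le_div_mul (P := P) (βi := βi) hmeas hnonneg (n := n) (t := 1 / 2 / x n)
      (s := 1 / x n) (by positivity) (by gcongr; norm_num) (by positivity)
    have e : 1 / 2 / x n / (1 / x n) = 1 / 2 := by field_simp
    rwa [e] at this
  have hhalf := (habs 1 one_pos).const_mul (1 / 2)
  have hhalf' := habs (1 / 2) (by norm_num)
  rw [Real.one_rpow] at hhalf
  rcases lt_or_gt_of_ne hβ1 with h | h
  · have hpow : (1 / 2 : ℝ) < (1 / 2) ^ β := by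
      simpa using Real.rpow_lt_rpow_of_exponent_gt (by norm_num : (0 : ℝ) < 1 / 2) (by norm_num) h
    have hlt : 1 / 2 * (|Real.Gamma (1 - β)| * 1) < |Real.Gamma (1 - β)| * (1 / 2) ^ β := by
      nlinarith
    have hcase : ∀ᶠ n in atTop, minIndex βi n < 1 := by
      filter_upwards [hhalf.eventually_lt hhalf' hlt, hconv, hδ, hxt.eventually_gt_atTop 0]
        with n h1 h2 h3 h4
      by_contra hc
      rw [abs_of_nonneg (sumDeviation_nonneg hmeas hnonneg (hint n) hc (by positivity)),
        abs_of_nonneg (sumDeviation_nonneg hmeas hnonneg (hint n) hc (by positivity)),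
        ← mul_div_assoc, div_lt_div_iff_of_pos_right h3] at h1
      linarith
    have := (habs lam hlam).neg
    rw [abs_of_pos (Real.Gamma_pos_of_pos (by linarith)), ← neg_mul] at this
    refine this.congr' ?_
    filter_upwards [hcase, hxt.eventually_gt_atTop 0] with n hc hn
    rw [abs_of_nonpos (sumDeviation_nonpos hmeas hnonneg hc (by positivity))]
    ring
  · have hpow : (1 / 2 : ℝ) ^ β < 1 / 2 := by
      simpa using Real.rpow_lt_rpow_of_exponent_gt (by norm_num : (0 : ℝ) < 1 / 2) (by norm_num) h
    have hlt : |Real.Gamma (1 - β)| * (1 / 2) ^ β < 1 / 2 * (|Real.Gamma (1 - β)| * 1) := by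
      nlinarith
    have hcase : ∀ᶠ n in atTop, ¬ minIndex βi n < 1 := by
      filter_upwards [hhalf'.eventually_lt hhalf hlt, hconv, hδ, hxt.eventually_gt_atTop 0]
        with n h1 h2 h3 h4 hc
      rw [abs_of_nonpos (sumDeviation_nonpos hmeas hnonneg hc (by positivity)),
        abs_of_nonpos (sumDeviation_nonpos hmeas hnonneg hc (by positivity)),
        ← mul_div_assoc, div_lt_div_iff_of_pos_right h3] at h1
      linarith
    have hGneg : Real.Gamma (1 - β) < 0 := by
      have h1 : 0 < Real.Gamma (1 - β + 1) := Real.Gamma_pos_of_pos (by linarith)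
      rw [Real.Gamma_add_one (by linarith)] at h1
      nlinarith
    have := habs lam hlam
    rw [abs_of_neg hGneg] at this
    refine this.congr' ?_
    filter_upwards [hcase, hxt.eventually_gt_atTop 0] with n hc hn
    rw [abs_of_nonneg (sumDeviation_nonneg hmeas hnonneg (hint n) hc (by positivity))]

theorem tendsto_tail_ratio (hmeas : ∀ n k, Measurable (X n k))
    (hnonneg : ∀ n k, ∀ᵐ ω ∂(P n), 0 ≤ X n k ω) (hindep : ∀ n, iIndepFun (X n) (P n))
    (hint : ∀ n, ¬ minIndex βi n < 1 → ∀ k, Integrable (X n k) (P n))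
    (hβ0 : 0 < β) (hβ2 : β < 2) (hβ1 : β ≠ 1)
    (hL : PosSepSlowlyVarying L) (hs_pos : ∀ n, 1 ≤ n → 0 < s n) (hs : Tendsto s atTop (𝓝 0))
    (hA : ∀ lam : ℝ, 0 < lam →
      Tendsto (fun n => ⨆ u ∈ Set.Ioc 0 (lam * s n),
        ENNReal.ofReal |(|sumDeviation P X βi n u
          / (Real.Gamma (1 - β) * L n (1 / u) * u ^ β)|) - 1|) atTop (𝓝 0))
    (hA0 : Tendsto (fun n => sumDeviation P X βi n (s n)) atTop (𝓝 0))
    (hx : ∀ n, 1 ≤ n → 1 / s n ≤ x n) :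
    Tendsto (fun n => (P n).real {ω | x n < rowSum X n ω - centering P X βi n}
      / (L n (x n) * x n ^ (-β))) atTop (𝓝 1) := by
  have hxt := tendsto_atTop_of_one_div_le hs_pos hs hx
  have hG : |Real.Gamma (1 - β)| ≠ 0 := abs_ne_zero.2 (Gamma_one_sub_ne_zero hβ2 hβ1)
  set δ : ℕ → ℝ := fun n => L n (x n) * x n ^ (-β) with hδdef
  have hδ : ∀ᶠ n in atTop, 0 < δ n := eventually_normalization_pos hL hxt
  have habs : ∀ lam : ℝ, 0 < lam →
      Tendsto (fun n => |sumDeviation P X βi n (lam / x n)| / δ n) atTop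
        (𝓝 (|Real.Gamma (1 - β)| * lam ^ β)) := fun lam hlam =>
    tendsto_abs_sumDeviation_div hβ2 hβ1 hL hs_pos hx hxt hlam (hA lam hlam)
  have hA1 : Tendsto (fun n => |sumDeviation P X βi n (1 / x n)|) atTop (𝓝 0) := by
    have h0 : Tendsto (fun n => |sumDeviation P X βi n (s n)|) atTop (𝓝 0) := by
      simpa using hA0.abs
    refine tendsto_of_tendsto_of_tendsto_of_le_of_le' tendsto_const_nhds h0
      (Eventually.of_forall fun n => abs_nonneg _) ?_
    filter_upwards [hxt.eventually_gt_atTop 0, eventually_ge_atTop 1] with n h1 h2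
    have hsn := hs_pos n h2
    refine abs_sumDeviation_mono hmeas hnonneg (hint n) (by positivity) ?_ hsn
    rw [one_div_le h1 hsn]
    exact hx n h2
  -- `δ` is `|A|` divided by `|A| / δ`: the numerator tends to `0` and the denominator to a nonzero
  -- constant.
  have hδ0 : Tendsto δ atTop (𝓝 0) := by
    have h1 := habs 1 one_pos
    rw [Real.one_rpow, mul_one] at h1
    have h2 := hA1.div h1 hG
    rw [zero_div] at h2
    refine h2.congr' ?_
    filter_upwards [hδ, h1.eventually_const_lt (abs_pos.2 (abs_ne_zero.1 hG))] with n hn hn1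
    have : |sumDeviation P X βi n (1 / x n)| ≠ 0 := by
      intro h; rw [h] at hn1; simp at hn1
    simp only [Pi.div_apply]
    field_simp
  have hAlam : ∀ lam : ℝ, 0 < lam →
      Tendsto (fun n => |sumDeviation P X βi n (lam / x n)|) atTop (𝓝 0) := fun lam hlam => by
    have := (habs lam hlam).mul hδ0
    rw [mul_zero] at this
    refine this.congr' (hδ.mono fun n hn => ?_)
    field_simp
  have hlim : ∀ k : ℕ, Tendsto (fun n => ((∫ ω, Real.exp
      (-(k * ((rowSum X n ω - centering P X βi n) / x n))) ∂(P n)) - 1) / δ n) atTop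
      (𝓝 (-Real.Gamma (1 - β) * (k : ℝ) ^ β)) := by
    intro k
    rcases Nat.eq_zero_or_pos k with rfl | hk
    · simp [Real.zero_rpow hβ0.ne']
    have hk' : (0 : ℝ) < k := Nat.cast_pos.2 hk
    have e : ∀ n ω, -((k : ℝ) * ((rowSum X n ω - centering P X βi n) / x n)) =
        -(k / x n) * (rowSum X n ω - centering P X βi n) := fun n ω => by ring
    simp_rw [e]
    have hmain := tendsto_sumDeviation_div hmeas hnonneg hint hβ2 hβ1 hxt hδ habs hk'
    have herr : Tendsto (fun n => ((∫ ω, Real.exp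
        (-(k / x n) * (rowSum X n ω - centering P X βi n)) ∂(P n)) - 1
          - sumDeviation P X βi n (k / x n)) / δ n) atTop (𝓝 0) := by
      -- The quadratic error divided by `δ` is `|A| * (|A| / δ)`, a null sequence times a convergent
      -- one.
      have hb := (hAlam k hk').mul (habs k hk')
      rw [zero_mul] at hb
      refine squeeze_zero_norm' ?_ hb
      filter_upwards [hδ, hxt.eventually_gt_atTop 0, (hAlam k hk').eventually_le_const one_pos]
        with n h1 h2 h3
      rw [norm_div, Real.norm_of_nonneg h1.le, Real.norm_eq_abs, ← mul_div_assoc]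
      refine div_le_div_of_nonneg_right ?_ h1.le
      rw [← pow_two, sq_abs]
      exact abs_integral_exp_rowSum_sub_le hmeas hnonneg (hindep n) (hint n) (by positivity) h3
    have := hmain.add herr
    rw [add_zero] at this
    refine this.congr fun n => ?_
    ring
  have hm : ∀ n, Measurable fun ω => (rowSum X n ω - centering P X βi n) / x n := fun n => by
    have : Measurable (rowSum X n) := Finset.measurable_sum _ fun k _ => hmeas n k
    exact (this.sub_const _).div_const _
  have key := tendsto_measureReal_one_lt_div hm hδ hβ0 hβ2 hβ1 ?_ hlim
  · refine key.congr' ?_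
    filter_upwards [hxt.eventually_gt_atTop 0] with n hn
    simp_rw [one_lt_div hn]
    rfl
  · filter_upwards [hxt.eventually_gt_atTop 0] with n hn k
    refine (integrable_exp_rowSum (βi := βi) hmeas hnonneg (n := n)
      (u := k / x n) (by positivity)).congr (Eventually.of_forall fun ω => ?_)
    simp only
    congr 1
    ring

end Sequence

end RegVar

/-! ### From sequences to uniform convergence -/

theorem tendsto_iSup_ofReal_abs_sub_one {f : ℕ → ℝ → ℝ} {s : ℕ → Set ℝ}
    (hne : ∀ n, (s n).Nonempty)
    (h : ∀ x : ℕ → ℝ, (∀ n, x n ∈ s n) → Tendsto (fun n => f n (x n)) atTop (𝓝 1)) :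
    Tendsto (fun n => ⨆ x ∈ s n, ENNReal.ofReal |f n x - 1|) atTop (𝓝 0) := by
  classical
  rw [ENNReal.tendsto_nhds_zero]
  intro ε hε
  choose d hd using hne
  -- A point violating the bound `ε` is selected whenever one exists, and an arbitrary point of the
  -- set otherwise; convergence along this sequence rules out violations for large `n`.
  let x : ℕ → ℝ := fun n =>
    if hb : ∃ y ∈ s n, ε < ENNReal.ofReal |f n y - 1| then hb.choose else d n
  have hxs : ∀ n, x n ∈ s n := fun n => by
    by_cases hb : ∃ y ∈ s n, ε < ENNReal.ofReal |f n y - 1|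
    · simp only [x, dif_pos hb]; exact hb.choose_spec.1
    · simp only [x, dif_neg hb]; exact hd n
  have h1 : Tendsto (fun n => ENNReal.ofReal |f n (x n) - 1|) atTop (𝓝 0) := by
    have := ENNReal.tendsto_ofReal ((h x hxs).sub_const 1).abs
    simpa using this
  filter_upwards [h1.eventually_le_const hε] with n hn
  refine iSup₂_le fun y hy => ?_
  by_contra hlt
  have hb : ∃ y ∈ s n, ε < ENNReal.ofReal |f n y - 1| := ⟨y, hy, not_le.1 hlt⟩
  have h2 := hb.choose_spec.2
  simp only [x, dif_pos hb] at hn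
  exact absurd hn (not_le.2 h2)

theorem mainTheorem3
    {Ω : ℕ → Type*} [∀ n, MeasurableSpace (Ω n)]
    (P : ∀ n, Measure (Ω n)) [∀ n, IsProbabilityMeasure (P n)]
    (X : ∀ n, Fin n → Ω n → ℝ)
    (hmeas : ∀ n k, Measurable (X n k))
    (hnonneg : ∀ n k, ∀ᵐ ω ∂(P n), 0 ≤ X n k ω)
    (hindep : ∀ n, iIndepFun (X n) (P n))
    (βi : ∀ n, Fin n → ℝ)
    (hβi : ∀ n k, 0 < βi n k ∧ βi n k < 2 ∧ βi n k ≠ 1)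
    (hRV : ∀ n k, RegVar.TailRegularlyVarying (P n) (X n k) (βi n k))
    (β : ℝ) (hβ0 : 0 < β) (hβ2 : β < 2) (hβ1 : β ≠ 1)
    (L : ℕ → ℝ → ℝ) (hL : RegVar.PosSepSlowlyVarying L)
    (s : ℕ → ℝ) (hs_pos : ∀ n, 1 ≤ n → 0 < s n) (hs : Tendsto s atTop (𝓝 0))
    (hA : ∀ lam : ℝ, 0 < lam →
      Tendsto (fun n => ⨆ u ∈ Set.Ioc 0 (lam * s n),
        ENNReal.ofReal |(|RegVar.sumDeviation P X βi n u
          / (Real.Gamma (1 - β) * L n (1 / u) * u ^ β)|) - 1|) atTop (𝓝 0))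
    (hA0 : Tendsto (fun n => RegVar.sumDeviation P X βi n (s n)) atTop (𝓝 0)) :
    Tendsto (fun n => ⨆ x ∈ Set.Ici (1 / s n),
      ENNReal.ofReal |(P n).real {ω | x < RegVar.rowSum X n ω - RegVar.centering P X βi n}
        / (L n x * x ^ (-β)) - 1|) atTop (𝓝 0) := by
  have hint : ∀ n, ¬ RegVar.minIndex βi n < 1 → ∀ k, Integrable (X n k) (P n) := fun n h k =>
    (hRV n k).integrable (hmeas n k) (hnonneg n k)
      (RegVar.one_lt_index_of_not_minIndex_lt hβi h k)
  exact tendsto_iSup_ofReal_abs_sub_one (s := fun n => Set.Ici (1 / s n))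
    (f := fun n x => (P n).real {ω | x < RegVar.rowSum X n ω - RegVar.centering P X βi n}
        / (L n x * x ^ (-β))) (fun n => Set.nonempty_Ici) fun x hx =>
    RegVar.tendsto_tail_ratio hmeas hnonneg hindep hint hβ0 hβ2 hβ1 hL hs_pos hs hA hA0
      fun n _ => hx n
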